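/- Let $l\ge 0$ and let $\lambda=(\lambda_0,\dots,\lambda_l)$ be integers with $0<\lambda_0<\lambda_1<\cdots<\lambda_l=r$. An $r$-permutation of $[n]$ is a rearrangement $w$ of the multiset $\{1^r,\dots,n^r\}$ such that every letter standing between two equal letters $a$ of $w$ is at most $a$. On words, define $S(\emptyset)=S_\lambda(\emptyset)=\emptyset$; if $m$ is the largest letter of a nonempty word $w=\alpha_0\,m\,\alpha_1\,m\cdots m\,\alpha_s$ (with $m$ in no $\alpha_j$), let $S(w)=S(\alpha_0)S(\alpha_1)\cdots S(\alpha_s)\,m$, and, when $s=r$, $$S_\lambda(w)=S_\lambda(\alpha_0)\cdots S_\lambda(\alpha_{\lambda_0})\,m\,S_\lambda(\alpha_{\lambda_0+1})\cdots S_\lambda(\alpha_{\lambda_1})\,m\cdots m\,S_\lambda(\alpha_{\lambda_{l-1}+1})\cdots S_\lambda(\alpha_{\lambda_l})\,m .$$ A $k$-tuple $r$-permutation of $[n]$ is a $k$-tuple $(\alpha_1,\dots,\alpha_k)$ of possibly empty words, no two sharing a letter, whose concatenation is an $r$-permutation of $[n]$; it is two-stack-sortable under $S_\lambda$ if $S(S_\lambda(\alpha_1)\cdots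 S_\lambda(\alpha_k))=1\,2\cdots n$. Let $p_n^{(k)}$ be the number of these, and let $$p_k=\sum_{n\ge0}p_n^{(k)}u^n,\qquad P=\sum_{k\ge0}p_k\,\bar z^k\in\mathbb Q[[u]][[\bar z]].$$ Theorem. The series $P$ is the unique element of $\mathbb Q[[u]][[\bar z]]$ that satisfies the functional equation $$P=\frac1{1-\bar z}+\frac{uP}{\bar z^{\lambda_0}}\Bigl(P-\sum_{i=0}^{\lambda_0}p_i\bar z^i\Bigr)\prod_{i=1}^{l}p_{\lambda_i-\lambda_{i-1}},$$ where $p_k$ denotes the coefficient of $\bar z^k$ in $P$. Moreover $$P=\left(1+\frac{t}{y(1+y)}\right)\frac{c(t)\,(1+y)^{\lambda_0+1}}{(1+y\,c(t))^{\lambda_0+1}},$$ where $c(t)=\sum_{n\ge0}\frac1{n+1}\binom{2n}{n}t^n=\frac{1-\sqrt{1-4t}}{2t}$ is the generating function of the Catalan numbers, $y$ is uniquely determined as a formal power series in $x$ by $$x=\frac{y}{(1+y)^{2\lambda_0+1}},$$ and $$x=u\prod_{i=1}^{l}p_{\lambda_i-\lambda_{i-1}},\qquad t=x(1+y)^{2(\lambda_0+1)}\frac{\bar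 z}{1-\bar z}=y(1+y)\frac{\bar z}{1-\bar z}.$$ -/

import Mathlib

open scoped PowerSeries

namespace StackSort

theorem length_lt_of_mem_splitOn {a : ℕ} {w b : List ℕ} (ha : a ∈ w) (hb : b ∈ w.splitOn a) :
    b.length < w.length := by
  have aux : ∀ w : List ℕ, ∀ b ∈ w.splitOn a, b.length ≤ w.length := by
    intro w
    induction w with
    | nil => simp [List.splitOn_nil]
    | cons c w ih =>
      intro b hb
      rw [List.splitOn_cons_eq_if_modifyHead] at hb
      split_ifs at hb with hc
      · rcases List.mem_cons.1 hb with rfl | hb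
        · simp
        · exact (ih b hb).trans (by simp)
      · cases h : w.splitOn a with
        | nil => simp [h] at hb
        | cons d L =>
          rw [h] at hb ih
          rcases List.mem_cons.1 hb with rfl | hb
          · simpa using ih d (by simp)
          · exact (ih b (by simp [hb])).trans (by simp)
  obtain ⟨s, t, rfl⟩ := List.append_of_mem ha
  rw [List.splitOn_append_cons_self, List.mem_append] at hb
  rcases hb with hb | hb
  · have := aux _ _ hb; simp; omega
  · have := aux _ _ hb; simp; omega

/-- The stack-sorting operation on words: `S(∅) = ∅`, and if `m` is the largest letter of `w` and
`w = α₀ m α₁ m ⋯ m α_r` (no `αᵢ` containing `m`), then `S(w) = S(α₀) S(α₁) ⋯ S(α_r) m`. -/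
def stackSort (w : List ℕ) : List ℕ :=
  if hw : w = [] then []
  else
    ((w.splitOn (w.max hw)).attach.map fun b => stackSort b.1).flatten ++ [w.max hw]
termination_by w.length
decreasing_by exact length_lt_of_mem_splitOn (List.max_mem hw) b.2

/-- The generalized stack-sorting operation `S_λ` for `λ = (λ₀, …, λ_l)`: `S_λ(∅) = ∅`, and if `m`
is the largest letter of `w` and `w = α₀ m α₁ m ⋯ m α_r`, then `S_λ(w)` is
`S_λ(α₀) ⋯ S_λ(α_{λ₀}) m S_λ(α_{λ₀+1}) ⋯ S_λ(α_{λ₁}) m ⋯ m S_λ(α_{λ_{l-1}+1}) ⋯ S_λ(α_{λ_l}) m`,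
that is, one letter `m` is written after `S_λ(α_j)` exactly for `j ∈ {λ₀, …, λ_l}`. -/
def genStackSort {l : ℕ} (lam : Fin (l + 1) → ℕ) (w : List ℕ) : List ℕ :=
  if hw : w = [] then []
  else
    ((w.splitOn (w.max hw)).attach.mapIdx fun j b =>
      genStackSort lam b.1 ++ if ∃ i, lam i = j then [w.max hw] else []).flatten
termination_by w.length
decreasing_by exact length_lt_of_mem_splitOn (List.max_mem hw) b.2

/-- `w` is an `r`-permutation of `[n]`: a rearrangement of `{1^r, …, n^r}` in which every letter
standing between two equal letters `a` is at most `a`. -/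
def IsRPerm (r n : ℕ) (w : List ℕ) : Prop :=
  (w : Multiset ℕ) = r • (Finset.Icc 1 n).val ∧ ∀ a b : ℕ, List.Sublist [a, b, a] w → b ≤ a

/-- `(α₁, …, α_k)` is a `k`-tuple `r`-permutation of `[n]`: the concatenation is an
`r`-permutation of `[n]` and any letter appears in only one component. Components may be empty. -/
def IsTupleRPerm (r n k : ℕ) (α : Fin k → List ℕ) : Prop :=
  IsRPerm r n (List.ofFn α).flatten ∧ ∀ i j, i ≠ j → List.Disjoint (α i) (α j)

/-- `S(S_λ(α₁) ⋯ S_λ(α_k))` is the identity permutation `1 2 ⋯ n`. -/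
def IsTwoStackSortable {l : ℕ} (lam : Fin (l + 1) → ℕ) (n k : ℕ) (α : Fin k → List ℕ) : Prop :=
  stackSort (List.ofFn fun i => genStackSort lam (α i)).flatten = List.range' 1 n

/-- The set of two-stack-sortable `k`-tuple `r`-permutations of `[n]` under `S_λ`. -/
def sortableTuples {l : ℕ} (r : ℕ) (lam : Fin (l + 1) → ℕ) (n k : ℕ) : Set (Fin k → List ℕ) :=
  {α | IsTupleRPerm r n k α ∧ IsTwoStackSortable lam n k α}

theorem sortableTuples_finite {l : ℕ} (r : ℕ) (lam : Fin (l + 1) → ℕ) (n k : ℕ) :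
    (sortableTuples r lam n k).Finite := by
  have hfin : {v : List ℕ | v.Subperm (r • (Finset.Icc 1 n).val).toList}.Finite := by
    refine Set.Finite.subset
      (List.finite_toSet ((r • (Finset.Icc 1 n).val).toList.sublists.flatMap List.permutations)) ?_
    rintro v ⟨v', hp, hs⟩
    simp only [Set.mem_ofPred_eq, List.mem_flatMap, List.mem_sublists, List.mem_permutations]
    exact ⟨v', hs, hp.symm⟩
  refine (Set.Finite.pi' (t := fun _ : Fin k => _) (fun _ => hfin)).subset ?_
  rintro α ⟨⟨⟨h, -⟩, -⟩, -⟩ i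
  have hsub : List.Sublist (α i) (List.ofFn α).flatten :=
    List.sublist_flatten_of_mem (by simp)
  refine hsub.subperm.trans (List.Perm.subperm ?_)
  rw [← Multiset.coe_eq_coe, h, Multiset.coe_toList]

/-- The ring `ℚ⟦u⟧⟦z̄⟧`. -/
abbrev Series := ℚ⟦X⟧⟦X⟧

/-- The fraction field of `ℚ⟦u⟧⟦z̄⟧`, in which all quotients below are taken. -/
abbrev SeriesFrac := FractionRing Series

/-- The embedding of `ℚ⟦u⟧⟦z̄⟧` in its fraction field. -/
noncomputable def toFrac : Series →+* SeriesFrac := algebraMap Series SeriesFrac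

/-- The embedding of `ℚ⟦u⟧` in the fraction field of `ℚ⟦u⟧⟦z̄⟧`. -/
noncomputable def ofU : ℚ⟦X⟧ →+* SeriesFrac := toFrac.comp PowerSeries.C

/-- The indeterminate `u`, which keeps track of the number of different letters. -/
noncomputable def uVar : SeriesFrac := ofU PowerSeries.X

/-- The indeterminate `z̄`, which keeps track of the number of components. -/
noncomputable def zVar : SeriesFrac := toFrac PowerSeries.X

/-- `P = ∑ₖ pₖ z̄ᵏ` with `pₖ = ∑ₙ pₙ⁽ᵏ⁾ uⁿ`, where `pₙ⁽ᵏ⁾` is the number of two-stack-sortable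
`k`-tuple `r`-permutations of `[n]` under `S_λ`. -/
noncomputable def genFun {l : ℕ} (r : ℕ) (lam : Fin (l + 1) → ℕ) : Series :=
  PowerSeries.mk fun k => PowerSeries.mk fun n => ((sortableTuples r lam n k).ncard : ℚ)

/-- `∏_{i=1}^{l} p_{λᵢ - λᵢ₋₁}`, where `pₖ` is the coefficient of `z̄ᵏ` in `P`. -/
noncomputable def gapProd {l : ℕ} (lam : Fin (l + 1) → ℕ) (P : Series) : ℚ⟦X⟧ :=
  ∏ i : Fin l, PowerSeries.coeff (lam i.succ - lam i.castSucc) P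

/-- The functional equation
`P = 1/(1-z̄) + (uP/z̄^{λ₀}) (P - ∑_{i=0}^{λ₀} pᵢ z̄ⁱ) ∏_{i=1}^{l} p_{λᵢ - λᵢ₋₁}`,
where `pₖ` is the coefficient of `z̄ᵏ` in `P`. -/
def SolvesFunctionalEquation {l : ℕ} (lam : Fin (l + 1) → ℕ) (P : Series) : Prop :=
  toFrac P = 1 / (1 - zVar) +
    uVar * toFrac P / zVar ^ lam 0 *
      (toFrac P - ∑ i ∈ Finset.range (lam 0 + 1), ofU (PowerSeries.coeff i P) * zVar ^ i) *
      ofU (gapProd lam P)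

/-- The generating function `∑ₙ Cₙ Xⁿ` of the Catalan numbers over `ℚ`. -/
noncomputable def catalanGF : ℚ⟦X⟧ := PowerSeries.catalanSeries.map (Nat.castRingHom ℚ)

end StackSort

open StackSort

/-! Everything rests on deleting the largest letter `m` of a `k`-tuple. It lies in a single
component, say the one preceded by `i` others, and cutting that component at `m` leaves `r + 1`
blocks, hence a `(k + r)`-tuple with one letter fewer. In `S_λ(α₁) ⋯ S_λ(α_k)` the surviving copies
of `m` separate these `k + r` words into consecutive groups of sizes `i + λ₀ + 1`, then the gaps
`λ_j - λ_{j-1}`, then `k - 1 - i`, and the final `S` sorts each group on its own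
(`stackSort_genConcat_insert`). The result is increasing exactly when the groups are sorted onto
consecutive intervals of letters. Counting gives `p_k = 1 + u ∏ p_{λ_j - λ_{j-1}} ∑_{i<k} p_{i+λ₀+1}
p_{k-1-i}`, which is the functional equation read coefficientwise (`chunkSet_succ`, `chunkSet_cons`,
`solvesWith_genFun`). Because the factor `x = u ∏ p_{λ_j - λ_{j-1}}` is divisible by `u`, the
equation determines the solution modulo successive powers of `u` (`SolvesWith.unique`).

For the closed form, `x` is regarded as given, and the same uniqueness reduces the claim to checking
that the proposed series `F` solves the equation with that `x` (`solvesWith_closedForm`). Put `m =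
λ₀`, `E = 1 + y`, and let `c`, `c'` be the roots of `c = 1 + t c²`. Then `y F` is `E^m (E - 1/c) /
(1 + y c)^m`. Adding its conjugate gives a trace, which satisfies a linear recurrence in `m` and is
therefore a polynomial in `z̄` of degree at most `m` (`exists_polynomial_powerSum`). As the
conjugate is divisible by `z̄^m`, this polynomial yields, after a correction in degree `m`, the
truncation of `y F` occurring in the equation, and what remains is algebra. -/

namespace StackSort

/-! ### Words whose letters between two equal letters are at most these letters -/

/-- Every letter between two equal letters `a` is at most `a`. -/
def Nested (w : List ℕ) : Prop := ∀ a b : ℕ, List.Sublist [a, b, a] w → b ≤ a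

theorem Nested.sublist {u v : List ℕ} (h : Nested v) (huv : List.Sublist u v) : Nested u :=
  fun a b hab => h a b (hab.trans huv)

theorem triple_sublist_append {a b : ℕ} {u v : List ℕ} (h : List.Sublist [a, b, a] (u ++ v)) :
    List.Sublist [a, b, a] u ∨ List.Sublist [a, b, a] v ∨ (a ∈ u ∧ a ∈ v) := by
  obtain ⟨l₁, l₂, h, h₁, h₂⟩ := List.sublist_append_iff.1 h
  match l₁, h with
  | [], h => exact Or.inr (Or.inl (by rw [List.nil_append] at h; rwa [h]))
  | [c], h =>
    simp only [List.cons_append, List.nil_append, List.cons.injEq] at h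
    obtain ⟨rfl, rfl⟩ := h
    exact Or.inr (Or.inr ⟨h₁.subset (by simp), h₂.subset (by simp)⟩)
  | [c, d], h =>
    simp only [List.cons_append, List.nil_append, List.cons.injEq] at h
    obtain ⟨rfl, rfl, rfl⟩ := h
    exact Or.inr (Or.inr ⟨h₁.subset (by simp), h₂.subset (by simp)⟩)
  | [c, d, e], h =>
    simp only [List.cons_append, List.nil_append, List.cons.injEq] at h
    obtain ⟨rfl, rfl, rfl, -⟩ := h
    exact Or.inl h₁
  | _ :: _ :: _ :: _ :: _, h => simp at h

theorem nested_append {u v : List ℕ} (h : List.Disjoint u v) :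
    Nested (u ++ v) ↔ Nested u ∧ Nested v := by
  refine ⟨fun H => ⟨H.sublist (List.sublist_append_left _ _),
    H.sublist (List.sublist_append_right _ _)⟩, fun ⟨hu, hv⟩ a b hab => ?_⟩
  rcases triple_sublist_append hab with h₁ | h₁ | ⟨h₁, h₂⟩
  · exact hu _ _ h₁
  · exact hv _ _ h₁
  · exact absurd h₂ (h h₁)

theorem nested_flatten {L : List (List ℕ)} (h : L.Pairwise List.Disjoint) :
    Nested L.flatten ↔ ∀ w ∈ L, Nested w := by
  induction L with
  | nil => simp [Nested]
  | cons w L ih =>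
    rw [List.pairwise_cons] at h
    rw [List.flatten_cons, nested_append, ih h.2, List.forall_mem_cons]
    rw [List.disjoint_left]
    intro x hx hx'
    obtain ⟨v, hv, hxv⟩ := List.mem_flatten.1 hx'
    exact h.1 v hv hx hxv

/-- A smaller letter on both sides of `m` would enclose the larger `m`. Conversely, a forbidden
pattern `a b a` cannot have `a = m`, so disjointness confines it to one side. -/
theorem nested_append_cons {m : ℕ} {u v : List ℕ} (hu : ∀ x ∈ u, x < m) (hv : ∀ x ∈ v, x ≤ m) :
    Nested (u ++ m :: v) ↔ Nested u ∧ Nested v ∧ List.Disjoint u v := by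
  constructor
  · refine fun H => ⟨H.sublist (by simp), H.sublist (by simp), List.disjoint_left.2 ?_⟩
    intro x hx hx'
    have : List.Sublist [x, m, x] (u ++ m :: v) :=
      (List.singleton_sublist.2 hx).append ((List.singleton_sublist.2 hx').cons_cons m)
    exact absurd (H _ _ this) (not_le.2 (hu x hx))
  · rintro ⟨h₁, h₂, h₃⟩ a b hab
    have hle : ∀ x ∈ u ++ m :: v, x ≤ m := by
      intro x hx
      rcases List.mem_append.1 hx with hx | hx
      · exact (hu x hx).le
      · rcases List.mem_cons.1 hx with rfl | hx
        exacts [le_rfl, hv x hx]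
    by_cases ham : a = m
    · exact ham ▸ hle b (hab.subset (by simp))
    rcases triple_sublist_append hab with h | h | ⟨h, h'⟩
    · exact h₁ _ _ h
    · rcases List.sublist_cons_iff.1 h with h | ⟨r, hr, -⟩
      · exact h₂ _ _ h
      · simp only [List.cons.injEq] at hr
        exact absurd hr.1 ham
    · rcases List.mem_cons.1 h' with h' | h'
      exacts [absurd h' ham, absurd h' (h₃ h)]

/-! ### Words written as blocks separated by their largest letter -/

theorem mem_intercalate_singleton {m x : ℕ} {bs : List (List ℕ)} :
    x ∈ [m].intercalate bs ↔ x ∈ bs.flatten ∨ (x = m ∧ 2 ≤ bs.length) := by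
  induction bs with
  | nil => simp
  | cons b bs ih =>
    cases bs with
    | nil => simp [List.intercalate_singleton]
    | cons c bs =>
      have e : (b :: c :: bs).flatten = b ++ (c :: bs).flatten := rfl
      rw [List.intercalate_cons_cons, List.mem_append, List.mem_append, ih, e, List.mem_append]
      simp only [List.mem_singleton, List.length_cons]
      constructor
      · rintro ((h | h) | h | h)
        exacts [Or.inl (Or.inl h), Or.inr ⟨h, by omega⟩, Or.inl (Or.inr h), Or.inr ⟨h.1, by omega⟩]
      · rintro ((h | h) | h)
        exacts [Or.inl (Or.inl h), Or.inr (Or.inl h), Or.inl (Or.inr h.1)]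

theorem count_intercalate_singleton {m x : ℕ} {bs : List (List ℕ)} :
    ([m].intercalate bs).count x =
      bs.flatten.count x + if x = m then bs.length - 1 else 0 := by
  induction bs with
  | nil => simp
  | cons b bs ih =>
    cases bs with
    | nil => simp [List.intercalate_singleton]
    | cons c bs =>
      have e : (b :: c :: bs).flatten = b ++ (c :: bs).flatten := rfl
      rw [List.intercalate_cons_cons, List.count_append, List.count_append, ih, e,
        List.count_append, List.count_singleton]
      by_cases h : x = m
      · subst h
        simp only [beq_self_eq_true, if_true, List.length_cons]
        omega
      · have h' : ¬ m = x := fun e => h e.symm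
        simp only [beq_iff_eq, h, h', if_false]
        omega

theorem intercalate_singleton_ne_nil {m : ℕ} {bs : List (List ℕ)} (h : 2 ≤ bs.length) :
    [m].intercalate bs ≠ [] :=
  List.ne_nil_of_mem (mem_intercalate_singleton.2 (Or.inr ⟨rfl, h⟩))

theorem max_intercalate {m : ℕ} {bs : List (List ℕ)} (h : 2 ≤ bs.length)
    (hm : ∀ b ∈ bs, ∀ x ∈ b, x < m) (hne : [m].intercalate bs ≠ []) :
    ([m].intercalate bs).max hne = m := by
  rw [List.max_eq_iff]
  refine ⟨mem_intercalate_singleton.2 (Or.inr ⟨rfl, h⟩), fun x hx => ?_⟩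
  rcases mem_intercalate_singleton.1 hx with hx | ⟨rfl, -⟩
  · obtain ⟨b, hb, hxb⟩ := List.mem_flatten.1 hx
    exact (hm b hb x hxb).le
  · exact le_rfl

theorem splitOn_intercalate_of_lt {m : ℕ} {bs : List (List ℕ)} (h : bs ≠ [])
    (hm : ∀ b ∈ bs, ∀ x ∈ b, x < m) : ([m].intercalate bs).splitOn m = bs :=
  List.splitOn_intercalate m (fun b hb hmem => (hm b hb m hmem).ne rfl) h

theorem not_mem_of_mem_splitOn {m : ℕ} {w b : List ℕ} (hb : b ∈ w.splitOn m) : m ∉ b := by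
  induction w generalizing b with
  | nil => simp_all [List.splitOn_nil]
  | cons c w ih =>
    rw [List.splitOn_cons_eq_if_modifyHead] at hb
    split_ifs at hb with hc
    · rcases List.mem_cons.1 hb with rfl | hb
      · simp
      · exact ih hb
    · cases h : w.splitOn m with
      | nil => simp [h] at hb
      | cons d L =>
        rw [h] at hb ih
        rcases List.mem_cons.1 hb with rfl | hb
        · have := @ih d (by simp)
          simp only [List.mem_cons, not_or]
          exact ⟨fun h => hc (by simp [h]), this⟩
        · exact ih (by simp [hb])

theorem mem_of_mem_splitOn {m x : ℕ} {w b : List ℕ} (hb : b ∈ w.splitOn m) (hx : x ∈ b) :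
    x ∈ w := by
  rw [← List.intercalate_splitOn (xs := w) m]
  exact mem_intercalate_singleton.2 (Or.inl (List.mem_flatten.2 ⟨b, hb, hx⟩))

theorem two_le_length_splitOn {m : ℕ} {w : List ℕ} (hw : m ∈ w) : 2 ≤ (w.splitOn m).length := by
  rw [← List.intercalate_splitOn (xs := w) m, mem_intercalate_singleton] at hw
  rcases hw with hw | hw
  · obtain ⟨b, hb, hxb⟩ := List.mem_flatten.1 hw
    exact absurd hxb (not_mem_of_mem_splitOn hb)
  · exact hw.2

theorem lt_of_mem_splitOn {m x : ℕ} {w b : List ℕ} (hle : ∀ x ∈ w, x ≤ m) (hb : b ∈ w.splitOn m)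
    (hx : x ∈ b) : x < m :=
  lt_of_le_of_ne (hle x (mem_of_mem_splitOn hb hx)) fun h => not_mem_of_mem_splitOn hb (h ▸ hx)

/-- Induction on words along the decomposition at the largest letter. -/
theorem word_induction {p : List ℕ → Prop} (nil : p [])
    (step : ∀ m bs, 2 ≤ List.length bs → (∀ b ∈ bs, ∀ x ∈ b, x < m) → (∀ b ∈ bs, p b) →
      p ([m].intercalate bs)) (w : List ℕ) : p w := by
  induction hn : w.length using Nat.strong_induction_on generalizing w with
  | _ n ih =>
    by_cases hw : w = []
    · exact hw ▸ nil
    have hmem := List.max_mem hw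
    rw [← List.intercalate_splitOn (xs := w) (w.max hw)]
    refine step _ _ (two_le_length_splitOn hmem)
      (fun b hb x hx => lt_of_mem_splitOn (fun y hy => List.le_max_of_mem hy) hb hx) ?_
    intro b hb
    exact ih _ (hn ▸ length_lt_of_mem_splitOn hmem hb) b rfl

/-! ### The sorting operations on words given by their blocks -/

theorem stackSort_nil : stackSort [] = [] := by rw [stackSort]; simp

theorem stackSort_intercalate {m : ℕ} {bs : List (List ℕ)} (h : 2 ≤ bs.length)
    (hm : ∀ b ∈ bs, ∀ x ∈ b, x < m) :
    stackSort ([m].intercalate bs) = (bs.map stackSort).flatten ++ [m] := by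
  rw [stackSort, dif_neg (intercalate_singleton_ne_nil h), max_intercalate h hm,
    splitOn_intercalate_of_lt (by rintro rfl; simp at h) hm]
  congr 2
  exact List.attach_map_val

theorem genStackSort_nil {l : ℕ} (lam : Fin (l + 1) → ℕ) : genStackSort lam [] = [] := by
  rw [genStackSort]; simp

theorem genStackSort_intercalate {l : ℕ} (lam : Fin (l + 1) → ℕ) {m : ℕ} {bs : List (List ℕ)}
    (h : 2 ≤ bs.length) (hm : ∀ b ∈ bs, ∀ x ∈ b, x < m) :
    genStackSort lam ([m].intercalate bs) =
      (bs.mapIdx fun j b => genStackSort lam b ++ if ∃ i, lam i = j then [m] else []).flatten := by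
  rw [genStackSort, dif_neg (intercalate_singleton_ne_nil h), max_intercalate h hm,
    splitOn_intercalate_of_lt (by rintro rfl; simp at h) hm]
  congr 1
  refine List.ext_getElem (by simp) fun i h₁ h₂ => ?_
  simp

theorem mem_stackSort {x : ℕ} (w : List ℕ) : x ∈ stackSort w ↔ x ∈ w := by
  induction w using word_induction with
  | nil => simp [stackSort_nil]
  | step m bs h hm ih =>
    rw [stackSort_intercalate h hm, mem_intercalate_singleton, List.mem_append]
    simp only [List.mem_flatten, List.mem_map, List.mem_singleton, h, and_true]
    refine or_congr ⟨?_, ?_⟩ Iff.rfl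
    · rintro ⟨_, ⟨b, hb, rfl⟩, hx⟩
      exact ⟨b, hb, (ih b hb).1 hx⟩
    · rintro ⟨b, hb, hx⟩
      exact ⟨_, ⟨b, hb, rfl⟩, (ih b hb).2 hx⟩

/-! ### Admissible tuples -/

/-- Every letter of `w` occurs `r` times, and `w` is nested. -/
def RWord (r : ℕ) (w : List ℕ) : Prop := (∀ x ∈ w, w.count x = r) ∧ Nested w

/-- A tuple of `r`-words no two of which share a letter. -/
def Admissible (r : ℕ) (L : List (List ℕ)) : Prop :=
  (∀ w ∈ L, RWord r w) ∧ L.Pairwise List.Disjoint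

theorem admissible_nil (r : ℕ) : Admissible r [] := by simp [Admissible]

theorem admissible_append {r : ℕ} {L M : List (List ℕ)} :
    Admissible r (L ++ M) ↔
      Admissible r L ∧ Admissible r M ∧ ∀ u ∈ L, ∀ v ∈ M, List.Disjoint u v := by
  simp only [Admissible, List.pairwise_append, List.forall_mem_append]
  tauto

theorem count_flatten_of_pairwise_disjoint {L : List (List ℕ)} (h : L.Pairwise List.Disjoint)
    {w : List ℕ} (hw : w ∈ L) {x : ℕ} (hx : x ∈ w) : L.flatten.count x = w.count x := by
  induction L with
  | nil => simp at hw
  | cons v L ih =>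
    rw [List.pairwise_cons] at h
    rw [List.flatten_cons, List.count_append]
    rcases List.mem_cons.1 hw with rfl | hw
    · rw [List.count_eq_zero_of_not_mem (l := L.flatten), add_zero]
      intro hx'
      obtain ⟨v, hv, hxv⟩ := List.mem_flatten.1 hx'
      exact h.1 v hv hx hxv
    · rw [ih h.2 hw, List.count_eq_zero_of_not_mem (fun hx' => h.1 w hw hx' hx), zero_add]

theorem forall_count_iff {r : ℕ} {L : List (List ℕ)} (h : L.Pairwise List.Disjoint) :
    (∀ x ∈ L.flatten, L.flatten.count x = r) ↔ ∀ w ∈ L, ∀ x ∈ w, w.count x = r := by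
  constructor
  · intro H w hw x hx
    rw [← count_flatten_of_pairwise_disjoint h hw hx]
    exact H x (List.mem_flatten.2 ⟨w, hw, hx⟩)
  · intro H x hx
    obtain ⟨w, hw, hxw⟩ := List.mem_flatten.1 hx
    rw [count_flatten_of_pairwise_disjoint h hw hxw, H w hw x hxw]

/-- This turns the condition on a single word into the condition on a tuple, so that cutting at the
largest letter stays within tuples of words with no common letters. -/
theorem nested_intercalate {m : ℕ} {bs : List (List ℕ)} (hm : ∀ b ∈ bs, ∀ x ∈ b, x < m) :
    Nested ([m].intercalate bs) ↔ (∀ b ∈ bs, Nested b) ∧ bs.Pairwise List.Disjoint := by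
  induction bs with
  | nil => simp [Nested]
  | cons b bs ih =>
    cases bs with
    | nil => simp [List.intercalate_singleton]
    | cons c bs =>
      rw [List.intercalate_cons_cons, List.append_assoc, List.singleton_append, nested_append_cons,
        ih (fun b hb => hm b (List.mem_cons_of_mem _ hb)), List.forall_mem_cons (a := b),
        List.pairwise_cons (a := b)]
      · have : List.Disjoint b ([m].intercalate (c :: bs)) ↔
            ∀ d ∈ c :: bs, List.Disjoint b d := by
          constructor
          · intro H d hd x hx hxd
            exact H hx (mem_intercalate_singleton.2 (Or.inl (List.mem_flatten.2 ⟨d, hd, hxd⟩)))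
          · intro H x hx hx'
            rcases mem_intercalate_singleton.1 hx' with h | ⟨rfl, -⟩
            · obtain ⟨d, hd, hxd⟩ := List.mem_flatten.1 h
              exact H d hd hx hxd
            · exact (hm b (by simp) x hx).ne rfl
        rw [this]
        tauto
      · exact hm b (by simp)
      · intro x hx
        rcases mem_intercalate_singleton.1 hx with h | ⟨rfl, -⟩
        · obtain ⟨d, hd, hxd⟩ := List.mem_flatten.1 h
          exact (hm d (List.mem_cons_of_mem _ hd) x hxd).le
        · exact le_rfl

theorem rWord_nil (r : ℕ) : RWord r [] := by simp [RWord, Nested]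

theorem rWord_intercalate {r m : ℕ} {bs : List (List ℕ)} (h : 2 ≤ bs.length)
    (hm : ∀ b ∈ bs, ∀ x ∈ b, x < m) :
    RWord r ([m].intercalate bs) ↔ bs.length = r + 1 ∧ Admissible r bs := by
  have hmem : m ∉ bs.flatten := by
    intro hx
    obtain ⟨b, hb, hxb⟩ := List.mem_flatten.1 hx
    exact (hm b hb m hxb).ne rfl
  have hcount : (∀ x ∈ [m].intercalate bs, ([m].intercalate bs).count x = r) ↔
      bs.length = r + 1 ∧ ∀ x ∈ bs.flatten, bs.flatten.count x = r := by
    constructor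
    · intro H
      constructor
      · have := H m (mem_intercalate_singleton.2 (Or.inr ⟨rfl, h⟩))
        rw [count_intercalate_singleton, List.count_eq_zero_of_not_mem hmem, if_pos rfl] at this
        omega
      · intro x hx
        have := H x (mem_intercalate_singleton.2 (Or.inl hx))
        rwa [count_intercalate_singleton, if_neg (fun e : x = m => hmem (by rwa [← e])), add_zero] at this
    · rintro ⟨hl, H⟩ x hx
      rw [count_intercalate_singleton]
      rcases mem_intercalate_singleton.1 hx with hx | ⟨rfl, -⟩
      · rw [if_neg (fun e : x = m => hmem (by rwa [← e])), add_zero, H x hx]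
      · rw [List.count_eq_zero_of_not_mem hmem, if_pos rfl]
        omega
  rw [RWord, nested_intercalate hm, hcount, Admissible]
  constructor
  · rintro ⟨⟨h₁, h₂⟩, h₃, h₄⟩
    exact ⟨h₁, fun w hw => ⟨(forall_count_iff h₄).1 h₂ w hw, h₃ w hw⟩, h₄⟩
  · rintro ⟨h₁, h₂, h₃⟩
    exact ⟨⟨h₁, (forall_count_iff h₃).2 fun w hw => (h₂ w hw).1⟩, fun w hw => (h₂ w hw).2, h₃⟩

/-- For an arbitrary word `S_λ` could lose the largest letter. With `r + 1` blocks and `λ_l = r`, a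
copy is always written after the last block. -/
theorem mem_genStackSort {r l : ℕ} {lam : Fin (l + 1) → ℕ} (hlast : lam (Fin.last l) = r)
    {x : ℕ} (w : List ℕ) (hw : RWord r w) : x ∈ genStackSort lam w ↔ x ∈ w := by
  induction w using word_induction with
  | nil => simp [genStackSort_nil]
  | step m bs h hm ih =>
    rw [rWord_intercalate h hm] at hw
    rw [genStackSort_intercalate lam h hm, mem_intercalate_singleton]
    simp only [List.mem_flatten, List.mem_mapIdx, h, and_true]
    have ih' : ∀ b ∈ bs, x ∈ genStackSort lam b ↔ x ∈ b := fun b hb => ih b hb (hw.2.1 b hb)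
    constructor
    · rintro ⟨_, ⟨j, hj, rfl⟩, hx⟩
      rcases List.mem_append.1 hx with hx | hx
      · exact Or.inl ⟨_, List.getElem_mem hj, (ih' _ (List.getElem_mem hj)).1 hx⟩
      · split_ifs at hx
        · exact Or.inr (by simpa using hx)
        · simp at hx
    · rintro (⟨b, hb, hx⟩ | rfl)
      · obtain ⟨j, hj, rfl⟩ := List.getElem_of_mem hb
        exact ⟨_, ⟨j, hj, rfl⟩, List.mem_append_left _ ((ih' _ hb).2 hx)⟩
      · refine ⟨_, ⟨r, by omega, rfl⟩, List.mem_append_right _ ?_⟩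
        rw [if_pos ⟨_, hlast⟩]
        simp


/-! ### Consecutive groups of components -/

theorem splitLengths_append {α : Type*} {gs hs : List ℕ} {A B : List α} (h : A.length = gs.sum) :
    (gs ++ hs).splitLengths (A ++ B) = gs.splitLengths A ++ hs.splitLengths B := by
  induction gs generalizing A with
  | nil =>
    rw [List.sum_nil, List.length_eq_zero_iff] at h
    simp [h]
  | cons g gs ih =>
    rw [List.sum_cons] at h
    rw [List.cons_append, List.splitLengths_cons, List.splitLengths_cons, List.cons_append,
      List.take_append_of_le_length (by omega), List.drop_append_of_le_length (by omega), ih]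
    rw [List.length_drop]
    omega

theorem splitLengths_singleton {α : Type*} {g : ℕ} {A : List α} (h : A.length = g) :
    [g].splitLengths A = [A] := by
  rw [List.splitLengths_cons, List.splitLengths_nil, List.take_of_length_le h.le]

theorem intercalate_append_singleton {m : ℕ} (xs : List (List ℕ)) (y : List ℕ) :
    [m].intercalate (xs ++ [y]) = (xs.map (· ++ [m])).flatten ++ y := by
  induction xs with
  | nil => simp [List.intercalate_singleton]
  | cons x xs ih =>
    rw [List.cons_append, List.intercalate_cons_of_ne_nil (by simp), ih]
    simp

/-- The successive differences `λ₁ - λ₀, …, λ_l - λ_{l-1}`. -/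
def gaps {l : ℕ} (lam : Fin (l + 1) → ℕ) : List ℕ :=
  List.ofFn fun i : Fin l => lam i.succ - lam i.castSucc

theorem gaps_succ {l : ℕ} (lam : Fin (l + 2) → ℕ) :
    gaps lam = (lam 1 - lam 0) :: gaps (fun i => lam i.succ) := by
  simp [gaps, List.ofFn_succ]

theorem sum_gaps {l : ℕ} {lam : Fin (l + 1) → ℕ} (hmono : Monotone lam) :
    (gaps lam).sum = lam (Fin.last l) - lam 0 := by
  induction l with
  | zero => simp [gaps]
  | succ l ih =>
    rw [gaps_succ, List.sum_cons, ih fun i j hij => hmono (Fin.succ_le_succ_iff.2 hij)]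
    have h₁ : lam 0 ≤ lam 1 := hmono (Fin.zero_le _)
    have h₂ : lam 1 ≤ lam (Fin.last (l + 1)) := hmono (Fin.le_last _)
    change lam 1 - lam 0 + (lam (Fin.last (l + 1)) - lam 1) = _
    omega

theorem mapIdx_mark_last {α : Type*} (f : α → List ℕ) (m : ℕ) (ch : List α) (p : ℕ → Prop)
    [DecidablePred p] (hne : ch ≠ []) (hp : ∀ j < ch.length, (p j ↔ j + 1 = ch.length)) :
    (ch.mapIdx fun j x => f x ++ if p j then [m] else []).flatten = (ch.map f).flatten ++ [m] := by
  induction ch generalizing p with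
  | nil => exact absurd rfl hne
  | cons x ch ih =>
    rw [List.mapIdx_cons, List.flatten_cons, List.map_cons, List.flatten_cons]
    by_cases hch : ch = []
    · subst hch
      rw [if_pos ((hp 0 (by simp)).2 (by simp))]
      simp
    · rw [ih (fun j => p (j + 1)) hch, if_neg]
      · simp
      · rw [hp 0 (by simp)]
        simpa [eq_comm] using hch
      · intro j hj
        rw [hp (j + 1) (by simpa using hj), List.length_cons]
        omega

/-- The offset `b` counts blocks already consumed. It is what makes the induction on `l` work: once
the first group is removed, the remaining marks are those of `λ₁, …, λ_l` with offset `λ₀ + 1`. -/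
theorem mapIdx_mark {α : Type*} (f : α → List ℕ) (m : ℕ) {l : ℕ} {lam : Fin (l + 1) → ℕ}
    (hmono : StrictMono lam) {b : ℕ} (hb : b ≤ lam 0) (p : ℕ → Prop) [DecidablePred p]
    (hp : ∀ j, p j ↔ ∃ i, lam i = j + b) {bs : List α}
    (hlen : bs.length + b = lam (Fin.last l) + 1) :
    (bs.mapIdx fun j x => f x ++ if p j then [m] else []).flatten =
      ((((lam 0 + 1 - b) :: gaps lam).splitLengths bs).map
        fun ch => (ch.map f).flatten ++ [m]).flatten := by
  induction l generalizing b bs p with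
  | zero =>
    have hl : lam (Fin.last 0) = lam 0 := rfl
    have hg : gaps lam = [] := by simp [gaps]
    rw [hg, splitLengths_singleton (by omega), mapIdx_mark_last]
    · simp
    · rintro rfl
      simp at hlen
      omega
    · intro j hj
      rw [hp]
      constructor
      · rintro ⟨i, hi⟩
        rw [Fin.fin_one_eq_zero i] at hi
        omega
      · intro h
        exact ⟨0, by omega⟩
  | succ l ih =>
    have hlt : lam 0 < lam 1 := hmono (by simp)
    have hle : lam 1 ≤ lam (Fin.last (l + 1)) := hmono.monotone (Fin.le_last _)
    obtain ⟨ch, rest, rfl, hch⟩ : ∃ ch rest, bs = ch ++ rest ∧ ch.length = lam 0 + 1 - b :=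
      ⟨_, _, (List.take_append_drop (lam 0 + 1 - b) bs).symm, by
        rw [List.length_take]; omega⟩
    rw [List.length_append] at hlen
    have hrest := ih (lam := fun i => lam i.succ) (hmono.comp Fin.strictMono_succ)
      (b := lam 0 + 1) hlt (fun j => p (j + ch.length)) (bs := rest) (fun j => by
        rw [hp]
        constructor
        · rintro ⟨i, hi⟩
          rcases Fin.eq_zero_or_eq_succ i with rfl | ⟨i, rfl⟩
          · omega
          · exact ⟨i, by omega⟩
        · rintro ⟨i, hi⟩
          exact ⟨i.succ, by omega⟩) (by
        show rest.length + (lam 0 + 1) = lam (Fin.last (l + 1)) + 1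
        omega)
    rw [List.mapIdx_append, List.flatten_append, hrest, mapIdx_mark_last,
      List.splitLengths_cons _ (gaps lam) (lam 0 + 1 - b), List.take_left' hch,
      List.drop_left' hch, List.map_cons, List.flatten_cons, gaps_succ, Fin.succ_zero_eq_one,
      Nat.add_sub_add_right]
    · rintro rfl
      simp at hch
      omega
    · intro j hj
      rw [hp]
      constructor
      · rintro ⟨i, hi⟩
        have := hmono.monotone (Fin.zero_le i)
        omega
      · intro h
        exact ⟨0, by omega⟩

/-- The concatenation `S_λ(α₁) ⋯ S_λ(α_k)`. -/
def genConcat {l : ℕ} (lam : Fin (l + 1) → ℕ) (L : List (List ℕ)) : List ℕ :=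
  (L.map (genStackSort lam)).flatten

theorem genConcat_append {l : ℕ} (lam : Fin (l + 1) → ℕ) (L M : List (List ℕ)) :
    genConcat lam (L ++ M) = genConcat lam L ++ genConcat lam M := by
  simp [genConcat]

theorem mem_genConcat {r l : ℕ} {lam : Fin (l + 1) → ℕ} (hlast : lam (Fin.last l) = r)
    {L : List (List ℕ)} (hL : ∀ w ∈ L, RWord r w) {x : ℕ} :
    x ∈ genConcat lam L ↔ x ∈ L.flatten := by
  simp only [genConcat, List.mem_flatten, List.mem_map]
  constructor
  · rintro ⟨_, ⟨w, hw, rfl⟩, hx⟩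
    exact ⟨w, hw, (mem_genStackSort hlast w (hL w hw)).1 hx⟩
  · rintro ⟨w, hw, hx⟩
    exact ⟨_, ⟨w, hw, rfl⟩, (mem_genStackSort hlast w (hL w hw)).2 hx⟩

/-- The concatenation of the words `S(S_λ(α_i) ⋯ S_λ(α_j))` over consecutive groups of components
of sizes `gs`. -/
def chunkSort {l : ℕ} (lam : Fin (l + 1) → ℕ) (gs : List ℕ) (M : List (List ℕ)) : List ℕ :=
  ((gs.splitLengths M).map fun ch => stackSort (genConcat lam ch)).flatten

theorem chunkSort_append {l : ℕ} (lam : Fin (l + 1) → ℕ) {gs hs : List ℕ} {A B : List (List ℕ)}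
    (h : A.length = gs.sum) :
    chunkSort lam (gs ++ hs) (A ++ B) = chunkSort lam gs A ++ chunkSort lam hs B := by
  simp [chunkSort, splitLengths_append h]

theorem chunkSort_singleton {l : ℕ} (lam : Fin (l + 1) → ℕ) {g : ℕ} {A : List (List ℕ)}
    (h : A.length = g) : chunkSort lam [g] A = stackSort (genConcat lam A) := by
  simp [chunkSort, splitLengths_singleton h]

theorem mem_chunkSort {r l : ℕ} {lam : Fin (l + 1) → ℕ} (hlast : lam (Fin.last l) = r)
    {gs : List ℕ} {M : List (List ℕ)} (hlen : M.length = gs.sum) (hM : ∀ w ∈ M, RWord r w)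
    {x : ℕ} : x ∈ chunkSort lam gs M ↔ x ∈ M.flatten := by
  have hfl : (gs.splitLengths M).flatten = M := List.flatten_splitLengths _ _ hlen.le
  have hsub : ∀ ch ∈ gs.splitLengths M, ∀ w ∈ ch, RWord r w := fun ch hch w hw =>
    hM w (hfl ▸ List.mem_flatten.2 ⟨ch, hch, hw⟩)
  conv_rhs => rw [← hfl]
  simp only [chunkSort, List.mem_flatten, List.mem_map]
  constructor
  · rintro ⟨_, ⟨ch, hch, rfl⟩, hx⟩
    rw [mem_stackSort, mem_genConcat hlast (hsub ch hch)] at hx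
    obtain ⟨w, hw, hxw⟩ := List.mem_flatten.1 hx
    exact ⟨w, ⟨ch, hch, hw⟩, hxw⟩
  · rintro ⟨w, ⟨ch, hch, hw⟩, hxw⟩
    refine ⟨_, ⟨ch, hch, rfl⟩, ?_⟩
    rw [mem_stackSort, mem_genConcat hlast (hsub ch hch)]
    exact List.mem_flatten.2 ⟨w, hw, hxw⟩

/-- The sizes of the groups of components obtained by deleting the largest letter from the
component number `i` of a `k`-tuple. -/
def splitSizes {l : ℕ} (lam : Fin (l + 1) → ℕ) (k i : ℕ) : List ℕ :=
  (i + (lam 0 + 1)) :: gaps lam ++ [k - 1 - i]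

theorem sum_splitSizes {r l : ℕ} {lam : Fin (l + 1) → ℕ} (hmono : StrictMono lam)
    (hlast : lam (Fin.last l) = r) {k i : ℕ} (hi : i < k) :
    (splitSizes lam k i).sum = k + r := by
  have := hmono.monotone (Fin.zero_le (Fin.last l))
  simp only [splitSizes, List.cons_append, List.sum_cons, List.sum_append,
    sum_gaps hmono.monotone, List.sum_nil]
  omega

theorem genStackSort_intercalate_eq {r l : ℕ} {lam : Fin (l + 1) → ℕ} (hpos : 0 < lam 0)
    (hmono : StrictMono lam) (hlast : lam (Fin.last l) = r) {m : ℕ} {bs : List (List ℕ)}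
    (hlen : bs.length = r + 1) (hm : ∀ b ∈ bs, ∀ x ∈ b, x < m) :
    genStackSort lam ([m].intercalate bs) =
      ((((lam 0 + 1) :: gaps lam).splitLengths bs).map
        fun ch => genConcat lam ch ++ [m]).flatten := by
  have := hmono.monotone (Fin.zero_le (Fin.last l))
  rw [genStackSort_intercalate lam (by omega) hm,
    mapIdx_mark (genStackSort lam) m hmono (Nat.zero_le _) _ (fun j => by simp) (by omega)]
  rfl

/-- The components before the cut one contain no `m`, so they merge with its first `λ₀ + 1` blocks
into one group. Since `S_λ` ends the cut component with `m`, the components after it form a group of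
their own, possibly empty. -/
theorem stackSort_genConcat_insert {r l : ℕ} {lam : Fin (l + 1) → ℕ} (hpos : 0 < lam 0)
    (hmono : StrictMono lam) (hlast : lam (Fin.last l) = r) {m k : ℕ} {L₁ bs L₂ : List (List ℕ)}
    (hlen : bs.length = r + 1) (hk : L₁.length + 1 + L₂.length = k)
    (hM : ∀ w ∈ L₁ ++ bs ++ L₂, RWord r w) (hm : ∀ b ∈ L₁ ++ bs ++ L₂, ∀ x ∈ b, x < m) :
    stackSort (genConcat lam (L₁ ++ [m].intercalate bs :: L₂)) =
      chunkSort lam (splitSizes lam k L₁.length) (L₁ ++ bs ++ L₂) ++ [m] := by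
  have hle := hmono.monotone (Fin.zero_le (Fin.last l))
  have hbs : ∀ b ∈ bs, ∀ x ∈ b, x < m := fun b hb => hm b (by simp [hb])
  obtain ⟨ch, rest, rfl, hch⟩ : ∃ ch rest, bs = ch ++ rest ∧ ch.length = lam 0 + 1 :=
    ⟨_, _, (List.take_append_drop (lam 0 + 1) bs).symm, by rw [List.length_take]; omega⟩
  have hrest : rest.length = (gaps lam).sum := by
    rw [sum_gaps hmono.monotone]
    rw [List.length_append] at hlen
    omega
  have hsplit : (splitSizes lam k L₁.length).splitLengths (L₁ ++ (ch ++ rest) ++ L₂) =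
      ((L₁ ++ ch) :: (gaps lam).splitLengths rest) ++ [L₂] := by
    rw [splitSizes, splitLengths_append, splitLengths_singleton (by omega), ← List.append_assoc]
    · rw [List.splitLengths_cons, List.take_left' (by simp [hch]), List.drop_left' (by simp [hch])]
    · simp only [List.length_append, List.sum_cons]
      omega
  have hfl : ((splitSizes lam k L₁.length).splitLengths (L₁ ++ (ch ++ rest) ++ L₂)).flatten =
      L₁ ++ (ch ++ rest) ++ L₂ := by
    refine List.flatten_splitLengths _ _ ?_
    rw [sum_splitSizes hmono hlast (by omega)]
    simp only [List.length_append] at hlen ⊢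
    omega
  have hconcat : genConcat lam (L₁ ++ [m].intercalate (ch ++ rest) :: L₂) =
      [m].intercalate (((splitSizes lam k L₁.length).splitLengths
        (L₁ ++ (ch ++ rest) ++ L₂)).map (genConcat lam)) := by
    rw [hsplit, List.map_append, List.map_singleton, intercalate_append_singleton,
      genConcat_append]
    have : genConcat lam ([m].intercalate (ch ++ rest) :: L₂) =
        genStackSort lam ([m].intercalate (ch ++ rest)) ++ genConcat lam L₂ := by simp [genConcat]
    rw [this, genStackSort_intercalate_eq hpos hmono hlast hlen hbs, List.splitLengths_cons,
      List.take_left' hch, List.drop_left' hch]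
    simp [genConcat_append, Function.comp_def]
  rw [hconcat, stackSort_intercalate]
  · simp [chunkSort, Function.comp_def]
  · simp [splitSizes]
  · intro b hb x hx
    obtain ⟨c, hc, rfl⟩ := List.mem_map.1 hb
    rw [mem_genConcat hlast fun w hw => hM w (hfl ▸ List.mem_flatten.2 ⟨c, hc, hw⟩)] at hx
    obtain ⟨w, hw, hxw⟩ := List.mem_flatten.1 hx
    exact hm w (hfl ▸ List.mem_flatten.2 ⟨c, hc, hw⟩) x hxw

/-- A word with letters below `m` shares a letter with the joined word exactly when it shares one
with some block, and `r + 1` blocks give `m` the right multiplicity. -/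
theorem admissible_insert {r m : ℕ} (hr : 0 < r) {L₁ bs L₂ : List (List ℕ)}
    (hlen : bs.length = r + 1) (hm : ∀ b ∈ L₁ ++ bs ++ L₂, ∀ x ∈ b, x < m) :
    Admissible r (L₁ ++ [m].intercalate bs :: L₂) ↔ Admissible r (L₁ ++ bs ++ L₂) := by
  have hbs : ∀ b ∈ bs, ∀ x ∈ b, x < m := fun b hb => hm b (by simp [hb])
  have hsingle : Admissible r [[m].intercalate bs] ↔ Admissible r bs := by
    rw [Admissible, List.forall_mem_singleton, rWord_intercalate (by omega) hbs]
    simp [hlen]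
  have hdisj : ∀ u, (∀ x ∈ u, x < m) →
      (List.Disjoint u ([m].intercalate bs) ↔ ∀ b ∈ bs, List.Disjoint u b) := by
    intro u hu
    constructor
    · intro H b hb x hx hxb
      exact H hx (mem_intercalate_singleton.2 (Or.inl (List.mem_flatten.2 ⟨b, hb, hxb⟩)))
    · intro H x hx hx'
      rcases mem_intercalate_singleton.1 hx' with h | ⟨rfl, -⟩
      · obtain ⟨b, hb, hxb⟩ := List.mem_flatten.1 h
        exact H b hb hx hxb
      · exact (hu x hx).ne rfl
  have h₁ : ∀ u ∈ L₁, ∀ x ∈ u, x < m := fun u hu => hm u (by simp [hu])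
  have h₂ : ∀ u ∈ L₂, ∀ x ∈ u, x < m := fun u hu => hm u (by simp [hu])
  have e : L₁ ++ [m].intercalate bs :: L₂ = L₁ ++ [[m].intercalate bs] ++ L₂ := by simp
  have hL₁ : (∀ u ∈ L₁, ∀ v ∈ [[m].intercalate bs], List.Disjoint u v) ↔
      ∀ u ∈ L₁, ∀ v ∈ bs, List.Disjoint u v :=
    forall₂_congr fun u hu => by rw [List.forall_mem_singleton, hdisj u (h₁ u hu)]
  have hL₂ : (∀ v ∈ L₂, List.Disjoint ([m].intercalate bs) v) ↔
      ∀ u ∈ bs, ∀ v ∈ L₂, List.Disjoint u v := by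
    constructor
    · exact fun H u hu v hv => ((hdisj v (h₂ v hv)).1 (H v hv).symm u hu).symm
    · exact fun H v hv => ((hdisj v (h₂ v hv)).2 fun u hu => (H u hu v hv).symm).symm
  rw [e, admissible_append, admissible_append, admissible_append, admissible_append, hsingle, hL₁,
    List.forall_mem_append, List.forall_mem_append, List.forall_mem_singleton, hL₂]


/-! ### Counting sortable tuples -/

theorem eq_range'_of_append_eq_range' {u v : List ℕ} {a n : ℕ} (h : u ++ v = List.range' a n) :
    u.length + v.length = n ∧ u = List.range' a u.length ∧
      v = List.range' (a + u.length) v.length := by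
  have hn : u.length + v.length = n := by
    rw [← List.length_append, h, List.length_range']
  have h' : List.range' a u.length ++ List.range' (a + u.length) v.length = u ++ v := by
    rw [h, ← hn]
    simp
  obtain ⟨h₁, h₂⟩ := List.append_inj h' (by simp)
  exact ⟨hn, h₁.symm, h₂.symm⟩

/-- The tuples whose groups of components of sizes `gs` are sorted into consecutive intervals which
fill `{a, …, a + n - 1}`. -/
def chunkSet {l : ℕ} (r : ℕ) (lam : Fin (l + 1) → ℕ) (a n : ℕ) (gs : List ℕ) :
    Set (List (List ℕ)) :=
  {M | M.length = gs.sum ∧ Admissible r M ∧ chunkSort lam gs M = List.range' a n}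

section

variable {r l : ℕ} {lam : Fin (l + 1) → ℕ}

theorem mem_chunkSet_singleton {a n k : ℕ} {M : List (List ℕ)} :
    M ∈ chunkSet r lam a n [k] ↔ M.length = k ∧ Admissible r M ∧
      stackSort (genConcat lam M) = List.range' a n := by
  simp only [chunkSet, Set.mem_ofPred_eq, List.sum_cons, List.sum_nil, add_zero]
  refine and_congr_right fun h => ?_
  rw [chunkSort_singleton lam h]

theorem mem_flatten_of_mem_chunkSet (hlast : lam (Fin.last l) = r) {a n : ℕ} {gs : List ℕ}
    {M : List (List ℕ)} (hM : M ∈ chunkSet r lam a n gs) {x : ℕ} :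
    x ∈ M.flatten ↔ a ≤ x ∧ x < a + n := by
  rw [← mem_chunkSort hlast hM.1 hM.2.1.1, hM.2.2, List.mem_range'_1]

theorem lt_of_mem_chunkSet (hlast : lam (Fin.last l) = r) {a n : ℕ} {gs : List ℕ}
    {M : List (List ℕ)} (hM : M ∈ chunkSet r lam a n gs) : ∀ b ∈ M, ∀ x ∈ b, x < a + n :=
  fun b hb _ hx => ((mem_flatten_of_mem_chunkSet hlast hM).1 (List.mem_flatten.2 ⟨b, hb, hx⟩)).2

theorem chunkSet_nil {a n : ℕ} : chunkSet r lam a n [] = if n = 0 then {[]} else ∅ := by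
  ext M
  simp only [chunkSet, Set.mem_ofPred_eq, List.sum_nil, List.length_eq_zero_iff, chunkSort,
    List.splitLengths_nil, List.map_nil, List.flatten_nil]
  split_ifs with h
  · subst h
    simp only [List.range'_zero, and_true, Set.mem_singleton_iff, and_iff_left_iff_imp]
    rintro rfl
    exact admissible_nil r
  · simp only [Set.mem_empty_iff_false, iff_false]
    rintro ⟨-, -, h'⟩
    exact h (List.range'_eq_nil_iff.1 h'.symm)

/-- The first group uses an initial interval of letters and the other groups the rest. Disjointness
between them is automatic, because sorting preserves the set of letters. The later groups do not
start at `1`, hence the parameter `a`. -/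
theorem chunkSet_cons (hlast : lam (Fin.last l) = r) {a n g : ℕ} {gs : List ℕ} :
    chunkSet r lam a n (g :: gs) = ⋃ p ∈ Finset.HasAntidiagonal.antidiagonal n,
      (fun q : List (List ℕ) × List (List ℕ) => q.1 ++ q.2) ''
        (chunkSet r lam a p.1 [g] ×ˢ chunkSet r lam (a + p.1) p.2 gs) := by
  ext M
  simp only [Set.mem_iUnion, Set.mem_image, Set.mem_prod, Prod.exists, exists_prop,
    Finset.HasAntidiagonal.mem_antidiagonal]
  constructor
  · rintro ⟨hlen, hadm, hsort⟩
    rw [List.sum_cons] at hlen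
    obtain ⟨A, B, rfl, hA⟩ : ∃ A B, M = A ++ B ∧ A.length = g :=
      ⟨_, _, (List.take_append_drop g M).symm, by rw [List.length_take]; omega⟩
    rw [List.length_append] at hlen
    rw [admissible_append] at hadm
    have hA' : A.length = [g].sum := by simpa using hA
    rw [← List.singleton_append, chunkSort_append lam hA'] at hsort
    obtain ⟨h₁, h₂, h₃⟩ := eq_range'_of_append_eq_range' hsort
    exact ⟨_, _, h₁, A, B, ⟨⟨hA', hadm.1, h₂⟩, by omega, hadm.2.1, h₃⟩, rfl⟩
  · rintro ⟨i, j, rfl, A, B, ⟨hA, hB⟩, rfl⟩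
    refine ⟨?_, admissible_append.2 ⟨hA.2.1, hB.2.1, ?_⟩, ?_⟩
    · rw [List.length_append, hA.1, hB.1, List.sum_cons, List.sum_cons, List.sum_nil, add_zero]
    · intro u hu v hv x hxu hxv
      have h₁ := (mem_flatten_of_mem_chunkSet hlast hA).1 (List.mem_flatten.2 ⟨u, hu, hxu⟩)
      have h₂ := (mem_flatten_of_mem_chunkSet hlast hB).1 (List.mem_flatten.2 ⟨v, hv, hxv⟩)
      omega
    · rw [← List.singleton_append, chunkSort_append lam hA.1, hA.2.2, hB.2.2]
      simp

theorem chunkSet_zero (hlast : lam (Fin.last l) = r) {a k : ℕ} :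
    chunkSet r lam a 0 [k] = {List.replicate k []} := by
  ext M
  rw [Set.mem_singleton_iff, List.eq_replicate_iff]
  constructor
  · intro h
    refine ⟨by simpa using h.1, fun b hb => List.eq_nil_iff_forall_not_mem.2 fun x hx => ?_⟩
    have := (mem_flatten_of_mem_chunkSet hlast h).1 (List.mem_flatten.2 ⟨b, hb, hx⟩)
    omega
  · rintro ⟨hlen, hM⟩
    rw [mem_chunkSet_singleton]
    have hadm : Admissible r M := by
      refine ⟨fun w hw => hM w hw ▸ rWord_nil r, ?_⟩
      rw [List.pairwise_iff_getElem]
      intro i j hi hj _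
      rw [hM _ (List.getElem_mem hi)]
      exact List.disjoint_nil_left _
    refine ⟨hlen, hadm, ?_⟩
    rw [List.range'_zero, List.eq_nil_iff_forall_not_mem]
    intro x hx
    rw [mem_stackSort, mem_genConcat hlast hadm.1, List.mem_flatten] at hx
    obtain ⟨w, hw, hx⟩ := hx
    rw [hM w hw] at hx
    simp at hx

/-- Replace the components number `i, …, i + r` by a single one, with `m` written between them. -/
def glue (r m i : ℕ) (M : List (List ℕ)) : List (List ℕ) :=
  M.take i ++ [m].intercalate ((M.drop i).take (r + 1)) :: (M.drop i).drop (r + 1)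

theorem glue_append {m : ℕ} {L₁ bs L₂ : List (List ℕ)} (hbs : bs.length = r + 1) :
    glue r m L₁.length (L₁ ++ bs ++ L₂) = L₁ ++ [m].intercalate bs :: L₂ := by
  rw [glue, List.append_assoc, List.take_left, List.drop_left, List.take_left' hbs,
    List.drop_left' hbs]

theorem exists_eq_append_of_length {M : List (List ℕ)} {k i : ℕ} (hlen : M.length = k + r)
    (hi : i < k) : ∃ L₁ bs L₂, M = L₁ ++ bs ++ L₂ ∧ L₁.length = i ∧ bs.length = r + 1 ∧
      L₁.length + 1 + L₂.length = k := by
  refine ⟨M.take i, (M.drop i).take (r + 1), (M.drop i).drop (r + 1), ?_, ?_, ?_, ?_⟩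
  · rw [List.append_assoc, List.take_append_drop, List.take_append_drop]
  all_goals
    simp only [List.length_take, List.length_drop]
    omega

/-- The combinatorial decomposition itself: `i` is the number of components before the one that
contains the largest letter `a + n`. -/
theorem chunkSet_succ (hpos : 0 < lam 0) (hmono : StrictMono lam)
    (hlast : lam (Fin.last l) = r) {a n k : ℕ} :
    chunkSet r lam a (n + 1) [k] = ⋃ i ∈ Finset.range k,
      glue r (a + n) i '' chunkSet r lam a n (splitSizes lam k i) := by
  have hr : 0 < r := hlast ▸ hpos.trans_le (hmono.monotone (Fin.zero_le _))
  have hrange : List.range' a (n + 1) = List.range' a n ++ [a + n] := by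
    rw [List.range'_concat, one_mul]
  ext L
  simp only [Set.mem_iUnion, Set.mem_image, exists_prop, Finset.mem_range]
  constructor
  · intro hL
    have hle : ∀ b ∈ L, ∀ x ∈ b, x ≤ a + n := fun b hb x hx =>
      Nat.lt_succ_iff.1 (lt_of_mem_chunkSet hlast hL b hb x hx)
    obtain ⟨w, hw, hmw⟩ := List.mem_flatten.1
      ((mem_flatten_of_mem_chunkSet hlast hL (x := a + n)).2 ⟨by omega, by omega⟩)
    obtain ⟨hlen, hadm, hsort⟩ := mem_chunkSet_singleton.1 hL
    obtain ⟨L₁, L₂, rfl⟩ := List.append_of_mem hw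
    -- Components are pairwise disjoint, so `a + n` occurs in `w` only, and cutting `w` at it
    -- removes every copy.
    have hlt : ∀ b ∈ L₁ ++ w.splitOn (a + n) ++ L₂, ∀ x ∈ b, x < a + n := by
      have hdisj := List.pairwise_append.1 hadm.2
      have hdisj₂ := List.pairwise_cons.1 hdisj.2.1
      intro b hb x hx
      rcases List.mem_append.1 hb with hb | hb
      · rcases List.mem_append.1 hb with hb | hb
        · refine lt_of_le_of_ne (hle b (by simp [hb]) x hx) ?_
          rintro rfl
          exact hdisj.2.2 b hb w (by simp) hx hmw
        · exact lt_of_mem_splitOn (hle w hw) hb hx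
      · refine lt_of_le_of_ne (hle b (by simp [hb]) x hx) ?_
        rintro rfl
        exact hdisj₂.1 b hb hmw hx
    obtain ⟨bs, hbs⟩ : ∃ bs, bs = w.splitOn (a + n) := ⟨_, rfl⟩
    have htwo : 2 ≤ bs.length := hbs ▸ two_le_length_splitOn hmw
    rw [← hbs] at hlt
    have hww : w = [a + n].intercalate bs := by rw [hbs, List.intercalate_splitOn]
    subst hww
    have hbl : bs.length = r + 1 :=
      ((rWord_intercalate htwo fun b hb => hlt b (by simp [hb])).1 (hadm.1 _ hw)).1
    have hk : L₁.length + 1 + L₂.length = k := by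
      rw [← hlen, List.length_append, List.length_cons]
      omega
    rw [admissible_insert hr hbl hlt] at hadm
    rw [stackSort_genConcat_insert hpos hmono hlast hbl hk hadm.1 hlt, hrange] at hsort
    refine ⟨L₁.length, by omega, L₁ ++ bs ++ L₂,
      ⟨?_, hadm, List.append_cancel_right hsort⟩, glue_append hbl⟩
    rw [sum_splitSizes hmono hlast (by omega), List.length_append, List.length_append]
    omega
  · rintro ⟨i, hi, M, hM, rfl⟩
    have hlen := hM.1
    rw [sum_splitSizes hmono hlast hi] at hlen
    obtain ⟨L₁, bs, L₂, rfl, rfl, hbl, hk⟩ := exists_eq_append_of_length hlen hi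
    have hlt := lt_of_mem_chunkSet hlast hM
    rw [glue_append hbl, mem_chunkSet_singleton, admissible_insert hr hbl hlt,
      stackSort_genConcat_insert hpos hmono hlast hbl hk hM.2.1.1 hlt, hM.2.2, hrange]
    refine ⟨?_, hM.2.1, rfl⟩
    rw [← hk, List.length_append, List.length_cons]
    omega

/-- The prefix is recovered as the longest initial run of components without `m`. -/
theorem insert_injective {m : ℕ} {L₁ L₂ L₁' L₂' : List (List ℕ)} {w w' : List ℕ}
    (h : L₁ ++ w :: L₂ = L₁' ++ w' :: L₂') (hw : m ∈ w) (hw' : m ∈ w')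
    (h₁ : ∀ b ∈ L₁, m ∉ b) (h₁' : ∀ b ∈ L₁', m ∉ b) : L₁ = L₁' ∧ w = w' ∧ L₂ = L₂' := by
  have key : ∀ (A B : List (List ℕ)) (v : List ℕ), m ∈ v → (∀ b ∈ A, m ∉ b) →
      (A ++ v :: B).takeWhile (fun b => decide (m ∉ b)) = A := by
    intro A B v hv hA
    rw [List.takeWhile_append_of_pos (by simpa using hA), List.takeWhile_cons_of_neg (by simpa using hv),
      List.append_nil]
  have e : L₁ = L₁' := by rw [← key L₁ L₂ w hw h₁, h, key L₁' L₂' w' hw' h₁']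
  subst e
  simpa using h

theorem glue_inj (hpos : 0 < lam 0) (hmono : StrictMono lam) (hlast : lam (Fin.last l) = r)
    {a n k i j : ℕ} (hi : i < k) (hj : j < k) {M N : List (List ℕ)}
    (hM : M ∈ chunkSet r lam a n (splitSizes lam k i))
    (hN : N ∈ chunkSet r lam a n (splitSizes lam k j))
    (h : glue r (a + n) i M = glue r (a + n) j N) : i = j ∧ M = N := by
  have hr : 0 < r := hlast ▸ hpos.trans_le (hmono.monotone (Fin.zero_le _))
  obtain ⟨L₁, bs, L₂, rfl, rfl, hbl, hk⟩ :=
    exists_eq_append_of_length (hM.1.trans (sum_splitSizes hmono hlast hi)) hi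
  obtain ⟨L₁', bs', L₂', rfl, rfl, hbl', hk'⟩ :=
    exists_eq_append_of_length (hN.1.trans (sum_splitSizes hmono hlast hj)) hj
  have hlt := lt_of_mem_chunkSet hlast hM
  have hlt' := lt_of_mem_chunkSet hlast hN
  rw [glue_append hbl, glue_append hbl'] at h
  obtain ⟨e₁, e, e₂⟩ := insert_injective (m := a + n) h
    (mem_intercalate_singleton.2 (Or.inr ⟨rfl, by omega⟩))
    (mem_intercalate_singleton.2 (Or.inr ⟨rfl, by omega⟩))
    (fun b hb hx => (hlt b (by simp [hb]) _ hx).ne rfl)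
    (fun b hb hx => (hlt' b (by simp [hb]) _ hx).ne rfl)
  have hsplit := congrArg (List.splitOn (a + n)) e
  rw [splitOn_intercalate_of_lt (by rintro rfl; simp at hbl) fun b hb => hlt b (by simp [hb]),
    splitOn_intercalate_of_lt (by rintro rfl; simp at hbl') fun b hb => hlt' b (by simp [hb])]
    at hsplit
  rw [e₁, e₂, hsplit]
  exact ⟨rfl, rfl⟩

/-- One half of a double induction: a single group with `n + 1` letters reduces to several groups
with `n` letters, and several groups reduce here to single groups with no more letters. -/
theorem finite_chunkSet_of_singleton (hlast : lam (Fin.last l) = r) {n : ℕ}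
    (h : ∀ j ≤ n, ∀ a k, (chunkSet r lam a j [k]).Finite) (gs : List ℕ) :
    ∀ j ≤ n, ∀ a, (chunkSet r lam a j gs).Finite := by
  induction gs with
  | nil =>
    intro j _ a
    rw [chunkSet_nil]
    split_ifs
    exacts [Set.finite_singleton _, Set.finite_empty]
  | cons g gs ih =>
    intro j hj a
    rw [chunkSet_cons hlast]
    refine Set.Finite.biUnion (Finset.finite_toSet _) fun p hp => ?_
    have := Finset.HasAntidiagonal.mem_antidiagonal.1 (Finset.mem_coe.1 hp)
    exact ((h _ (by omega) _ _).prod (ih _ (by omega) _)).image _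

theorem finite_chunkSet (hpos : 0 < lam 0) (hmono : StrictMono lam)
    (hlast : lam (Fin.last l) = r) (a n : ℕ) (gs : List ℕ) : (chunkSet r lam a n gs).Finite := by
  refine finite_chunkSet_of_singleton (n := n) hlast ?_ gs n le_rfl a
  induction n with
  | zero =>
    intro j hj a k
    rw [Nat.le_zero.1 hj, chunkSet_zero hlast]
    exact Set.finite_singleton _
  | succ n ih =>
    intro j hj a k
    rcases Nat.le_succ_iff.1 hj with hj | rfl
    · exact ih j hj a k
    · rw [chunkSet_succ hpos hmono hlast]
      exact Set.Finite.biUnion (Finset.finite_toSet _) fun i _ =>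
        (finite_chunkSet_of_singleton hlast ih _ n le_rfl a).image _

theorem ncard_biUnion_finset {ι α : Type*} (t : Finset ι) {s : ι → Set α}
    (hs : ∀ i ∈ t, (s i).Finite) (h : (t : Set ι).PairwiseDisjoint s) :
    (⋃ i ∈ t, s i).ncard = ∑ i ∈ t, (s i).ncard := by
  have := (Finset.finite_toSet t).ncard_biUnion (fun i hi => hs i (Finset.mem_coe.1 hi)) h
  rw [finsum_mem_coe_finset] at this
  exact this

theorem ncard_chunkSet_nil (a n : ℕ) :
    (chunkSet r lam a n []).ncard = if n = 0 then 1 else 0 := by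
  rw [chunkSet_nil]
  split_ifs <;> simp

theorem ncard_chunkSet_zero (hlast : lam (Fin.last l) = r) (a k : ℕ) :
    (chunkSet r lam a 0 [k]).ncard = 1 := by
  rw [chunkSet_zero hlast, Set.ncard_singleton]

theorem ncard_chunkSet_cons (hpos : 0 < lam 0) (hmono : StrictMono lam)
    (hlast : lam (Fin.last l) = r) (a n g : ℕ) (gs : List ℕ) :
    (chunkSet r lam a n (g :: gs)).ncard = ∑ p ∈ Finset.HasAntidiagonal.antidiagonal n,
      (chunkSet r lam a p.1 [g]).ncard * (chunkSet r lam (a + p.1) p.2 gs).ncard := by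
  have hfin := finite_chunkSet hpos hmono hlast
  rw [chunkSet_cons hlast, ncard_biUnion_finset]
  · refine Finset.sum_congr rfl fun p _ => ?_
    rw [Set.InjOn.ncard_image, Set.ncard_prod]
    rintro ⟨A, B⟩ ⟨hA, -⟩ ⟨A', B'⟩ ⟨hA', -⟩ h
    obtain ⟨h₁, h₂⟩ := List.append_inj h (hA.1.trans hA'.1.symm)
    exact Prod.ext h₁ h₂
  · exact fun p _ => ((hfin _ _ _).prod (hfin _ _ _)).image _
  · intro p hp q hq hpq
    rw [Function.onFun, Set.disjoint_left]
    rintro _ ⟨⟨A, B⟩, ⟨hA, -⟩, rfl⟩ ⟨⟨A', B'⟩, ⟨hA', -⟩, h⟩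
    obtain ⟨h₁, -⟩ := List.append_inj h (hA'.1.trans hA.1.symm)
    dsimp only at h₁ hA hA'
    have hp' := Finset.HasAntidiagonal.mem_antidiagonal.1 (Finset.mem_coe.1 hp)
    have hq' := Finset.HasAntidiagonal.mem_antidiagonal.1 (Finset.mem_coe.1 hq)
    have := hA.2.2.symm.trans (h₁ ▸ hA'.2.2)
    have := congrArg List.length this
    rw [List.length_range', List.length_range'] at this
    exact hpq (Prod.ext this (by omega))

theorem ncard_chunkSet_succ (hpos : 0 < lam 0) (hmono : StrictMono lam)
    (hlast : lam (Fin.last l) = r) (a n k : ℕ) :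
    (chunkSet r lam a (n + 1) [k]).ncard =
      ∑ i ∈ Finset.range k, (chunkSet r lam a n (splitSizes lam k i)).ncard := by
  have hfin := finite_chunkSet hpos hmono hlast
  rw [chunkSet_succ hpos hmono hlast, ncard_biUnion_finset]
  · refine Finset.sum_congr rfl fun i hi => Set.InjOn.ncard_image fun M hM N hN h => ?_
    have hi' := Finset.mem_range.1 hi
    exact (glue_inj hpos hmono hlast hi' hi' hM hN h).2
  · exact fun i _ => (hfin _ _ _).image _
  · intro i hi j hj hij
    rw [Function.onFun, Set.disjoint_left]
    rintro _ ⟨M, hM, rfl⟩ ⟨N, hN, h⟩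
    exact hij (glue_inj hpos hmono hlast (Finset.mem_range.1 (Finset.mem_coe.1 hi))
      (Finset.mem_range.1 (Finset.mem_coe.1 hj)) hM hN h.symm).1

/-- Translation invariance is read off from the recurrences for the counts, with the same double
induction as for finiteness, so no relabelling of words is needed. -/
theorem ncard_chunkSet_of_singleton (hpos : 0 < lam 0) (hmono : StrictMono lam)
    (hlast : lam (Fin.last l) = r) {n : ℕ}
    (h : ∀ j ≤ n, ∀ a k, (chunkSet r lam a j [k]).ncard = (chunkSet r lam 1 j [k]).ncard)
    (gs : List ℕ) :
    ∀ j ≤ n, ∀ a, (chunkSet r lam a j gs).ncard = (chunkSet r lam 1 j gs).ncard := by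
  induction gs with
  | nil =>
    intro j _ a
    rw [ncard_chunkSet_nil, ncard_chunkSet_nil]
  | cons g gs ih =>
    intro j hj a
    rw [ncard_chunkSet_cons hpos hmono hlast, ncard_chunkSet_cons hpos hmono hlast]
    refine Finset.sum_congr rfl fun p hp => ?_
    have := Finset.HasAntidiagonal.mem_antidiagonal.1 hp
    rw [h p.1 (by omega) a, ih p.2 (by omega) (a + p.1), ih p.2 (by omega) (1 + p.1)]

/-- The number of sortable tuples does not depend on the interval of letters used. -/
theorem ncard_chunkSet_eq (hpos : 0 < lam 0) (hmono : StrictMono lam)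
    (hlast : lam (Fin.last l) = r) (a n : ℕ) (gs : List ℕ) :
    (chunkSet r lam a n gs).ncard = (chunkSet r lam 1 n gs).ncard := by
  refine ncard_chunkSet_of_singleton (n := n) hpos hmono hlast ?_ gs n le_rfl a
  induction n with
  | zero =>
    intro j hj a k
    rw [Nat.le_zero.1 hj, ncard_chunkSet_zero hlast, ncard_chunkSet_zero hlast]
  | succ n ih =>
    intro j hj a k
    rcases Nat.le_succ_iff.1 hj with hj | rfl
    · exact ih j hj a k
    · rw [ncard_chunkSet_succ hpos hmono hlast, ncard_chunkSet_succ hpos hmono hlast]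
      exact Finset.sum_congr rfl fun i _ =>
        ncard_chunkSet_of_singleton hpos hmono hlast ih _ n le_rfl a

/-- The right-hand side does not prescribe the letters. That they are `1, …, n` follows from
sortability, because `S` and `S_λ` preserve the set of letters here. -/
theorem mem_sortableTuples_iff (hlast : lam (Fin.last l) = r) {n k : ℕ} {α : Fin k → List ℕ} :
    α ∈ sortableTuples r lam n k ↔ List.ofFn α ∈ chunkSet r lam 1 n [k] := by
  rw [mem_chunkSet_singleton]
  have hdisj : (∀ i j, i ≠ j → List.Disjoint (α i) (α j)) ↔
      (List.ofFn α).Pairwise List.Disjoint := by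
    rw [List.pairwise_ofFn]
    constructor
    · exact fun h i j hij => h i j hij.ne
    · intro h i j hij
      rcases lt_or_gt_of_ne hij with hij | hij
      exacts [h hij, (h hij).symm]
  have hcat : (List.ofFn fun i => genStackSort lam (α i)).flatten = genConcat lam (List.ofFn α) := by
    rw [genConcat, List.map_ofFn]
    rfl
  have hcount : ∀ x, (r • (Finset.Icc 1 n).val).count x = if 1 ≤ x ∧ x ≤ n then r else 0 := by
    intro x
    rw [Multiset.count_nsmul, Multiset.count_eq_of_nodup (Finset.nodup _)]
    simp
  have hmem : ∀ x, x ∈ List.range' 1 n ↔ 1 ≤ x ∧ x ≤ n := by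
    intro x
    rw [List.mem_range'_1]
    omega
  simp only [sortableTuples, IsTupleRPerm, IsRPerm, IsTwoStackSortable, Set.mem_ofPred_eq, hcat,
    hdisj, List.length_ofFn, true_and]
  change ((_ ∧ Nested _) ∧ _) ∧ _ ↔ _
  constructor
  · rintro ⟨⟨⟨h₁, h₂⟩, h₃⟩, h₄⟩
    refine ⟨⟨fun w hw => ⟨?_, (nested_flatten h₃).1 h₂ w hw⟩, h₃⟩, h₄⟩
    refine (forall_count_iff h₃).1 (fun x hx => ?_) w hw
    have hx' := List.count_pos_iff.2 hx
    have := hcount x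
    rw [← h₁, Multiset.coe_count] at this
    split_ifs at this
    · exact this
    · omega
  · rintro ⟨⟨h₁, h₂⟩, h₃⟩
    refine ⟨⟨⟨?_, (nested_flatten h₂).2 fun w hw => (h₁ w hw).2⟩, h₂⟩, h₃⟩
    ext x
    have hx : x ∈ (List.ofFn α).flatten ↔ 1 ≤ x ∧ x ≤ n := by
      rw [← mem_genConcat hlast h₁, ← mem_stackSort, h₃, hmem]
    rw [hcount, Multiset.coe_count]
    split_ifs with h
    · exact (forall_count_iff h₂).2 (fun w hw => (h₁ w hw).1) x (hx.2 h)
    · exact List.count_eq_zero_of_not_mem fun h' => h (hx.1 h')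

theorem ncard_sortableTuples (hlast : lam (Fin.last l) = r) (n k : ℕ) :
    (sortableTuples r lam n k).ncard = (chunkSet r lam 1 n [k]).ncard := by
  rw [← Set.ncard_image_of_injective _ (List.ofFn_injective (α := List ℕ) (n := k))]
  congr 1
  ext M
  constructor
  · rintro ⟨α, hα, rfl⟩
    exact (mem_sortableTuples_iff hlast).1 hα
  · intro hM
    obtain rfl : M.length = k := by simpa using hM.1
    refine ⟨M.get, (mem_sortableTuples_iff hlast).2 ?_, List.ofFn_get M⟩
    rwa [List.ofFn_get]

end


/-! ### The functional equation as a recurrence -/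

/-- The series `∑ⱼ q_{j+d} z̄ʲ`. -/
noncomputable def shift (d : ℕ) (Q : Series) : Series :=
  PowerSeries.mk fun j => PowerSeries.coeff (j + d) Q

theorem sub_trunc_eq (d : ℕ) (Q : Series) :
    Q - ∑ i ∈ Finset.range d, PowerSeries.C (PowerSeries.coeff i Q) * PowerSeries.X ^ i =
      PowerSeries.X ^ d * shift d Q := by
  ext1 n
  rw [map_sub, map_sum, PowerSeries.coeff_X_pow_mul']
  simp only [PowerSeries.coeff_C_mul, PowerSeries.coeff_X_pow, mul_ite, mul_one, mul_zero,
    Finset.sum_ite_eq, Finset.mem_range, shift, PowerSeries.coeff_mk]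
  split_ifs with h₁ h₂ h₂
  · omega
  · simp
  · rw [Nat.sub_add_cancel h₂, sub_zero]
  · omega

/-- The series `1 / (1 - z̄)`. -/
noncomputable def geomSeries : Series := PowerSeries.mk 1

theorem geomSeries_mul : geomSeries * (1 - PowerSeries.X) = 1 :=
  PowerSeries.mk_one_mul_one_sub_eq_one _

/-- The functional equation with the factor `u ∏ p_{λᵢ - λᵢ₋₁}` replaced by a series `x`. -/
def SolvesWith (m : ℕ) (x : ℚ⟦X⟧) (Q : Series) : Prop :=
  Q = geomSeries + PowerSeries.C x * PowerSeries.X * (shift (m + 1) Q * Q)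

/-- The coefficient of `z̄^k` on both sides. This is the form in which the equation meets the
counting recurrence. -/
theorem solvesWith_iff {m : ℕ} {x : ℚ⟦X⟧} {Q : Series} :
    SolvesWith m x Q ↔ ∀ k, PowerSeries.coeff k Q = 1 + x * ∑ i ∈ Finset.range k,
      PowerSeries.coeff (i + (m + 1)) Q * PowerSeries.coeff (k - 1 - i) Q := by
  rw [SolvesWith, PowerSeries.ext_iff]
  refine forall_congr' fun k => ?_
  rw [map_add, mul_assoc, PowerSeries.coeff_C_mul, geomSeries, PowerSeries.coeff_mk, Pi.one_apply]
  cases k with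
  | zero => simp
  | succ k =>
    rw [PowerSeries.coeff_succ_X_mul, PowerSeries.coeff_mul,
      Finset.Nat.sum_antidiagonal_eq_sum_range_succ_mk]
    simp [shift]

theorem toFrac_injective : Function.Injective toFrac := IsFractionRing.injective _ _

theorem zVar_ne_zero : zVar ≠ 0 :=
  (map_ne_zero_iff _ toFrac_injective).2 PowerSeries.X_ne_zero

theorem one_sub_zVar_ne_zero : 1 - zVar ≠ 0 := by
  have : toFrac geomSeries * (1 - zVar) = 1 := by
    rw [zVar, ← map_one toFrac, ← map_sub, ← map_mul, geomSeries_mul]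
  exact right_ne_zero_of_mul_eq_one this

theorem toFrac_geomSeries : toFrac geomSeries = 1 / (1 - zVar) := by
  rw [eq_div_iff one_sub_zVar_ne_zero, zVar, ← map_one toFrac, ← map_sub, ← map_mul,
    geomSeries_mul]

theorem solvesFunctionalEquation_iff {l : ℕ} {lam : Fin (l + 1) → ℕ} {Q : Series} :
    SolvesFunctionalEquation lam Q ↔ SolvesWith (lam 0) (PowerSeries.X * gapProd lam Q) Q := by
  have hsum : toFrac Q - ∑ i ∈ Finset.range (lam 0 + 1),
      ofU (PowerSeries.coeff i Q) * zVar ^ i =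
      zVar ^ (lam 0 + 1) * toFrac (shift (lam 0 + 1) Q) := by
    rw [zVar, ← map_pow, ← map_mul, ← sub_trunc_eq, map_sub, map_sum]
    simp [ofU]
  have hu : toFrac (PowerSeries.C PowerSeries.X * PowerSeries.C (gapProd lam Q)) =
      uVar * ofU (gapProd lam Q) := by
    rw [map_mul]
    rfl
  rw [SolvesFunctionalEquation, SolvesWith, hsum, ← toFrac_injective.eq_iff, map_add, map_mul,
    map_mul, map_mul, toFrac_geomSeries, hu, map_mul toFrac (shift _ _)]
  have : uVar * toFrac Q / zVar ^ lam 0 * (zVar ^ (lam 0 + 1) * toFrac (shift (lam 0 + 1) Q)) *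
      ofU (gapProd lam Q) = uVar * ofU (gapProd lam Q) * toFrac PowerSeries.X *
        (toFrac (shift (lam 0 + 1) Q) * toFrac Q) := by
    have h := pow_ne_zero (lam 0) zVar_ne_zero
    change _ = uVar * ofU (gapProd lam Q) * zVar * _
    field_simp
    ring
  rw [this]

theorem mul_sub_mul_eq {R : Type*} [CommRing R] (a b c d : R) :
    a * b - c * d = a * (b - d) + (a - c) * d := by ring

/-- A solution of the functional equation is determined by its factor `x`, also if this factor
depends on the solution. -/
theorem SolvesWith.unique {m : ℕ} {x x' : ℚ⟦X⟧} {Q Q' : Series} (hQ : SolvesWith m x Q)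
    (hQ' : SolvesWith m x' Q') (hx : PowerSeries.X ∣ x)
    (hxx : ∀ n, (∀ k, PowerSeries.X ^ n ∣ PowerSeries.coeff k Q - PowerSeries.coeff k Q') →
      PowerSeries.X ^ (n + 1) ∣ x - x') : Q = Q' := by
  rw [solvesWith_iff] at hQ hQ'
  -- Agreement modulo `u^n` must be assumed for all `k` at once, since the coefficient at `k`
  -- involves those at indices up to `k + m`. The factor `x` gains one power of `u`.
  have key : ∀ n k, PowerSeries.X ^ n ∣ PowerSeries.coeff k Q - PowerSeries.coeff k Q' := by
    intro n
    induction n with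
    | zero => simp
    | succ n ih =>
      intro k
      have e : PowerSeries.coeff k Q - PowerSeries.coeff k Q' =
          x * (∑ i ∈ Finset.range k,
            PowerSeries.coeff (i + (m + 1)) Q * PowerSeries.coeff (k - 1 - i) Q -
          ∑ i ∈ Finset.range k,
            PowerSeries.coeff (i + (m + 1)) Q' * PowerSeries.coeff (k - 1 - i) Q') +
          (x - x') * ∑ i ∈ Finset.range k,
            PowerSeries.coeff (i + (m + 1)) Q' * PowerSeries.coeff (k - 1 - i) Q' := by
        rw [hQ k, hQ' k]
        ring
      rw [e]
      refine dvd_add ?_ ((hxx n ih).mul_right _)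
      rw [pow_succ', ← Finset.sum_sub_distrib]
      refine mul_dvd_mul hx (Finset.dvd_sum fun i _ => ?_)
      rw [mul_sub_mul_eq]
      exact dvd_add ((ih _).mul_left _) ((ih _).mul_right _)
  ext k n
  have := PowerSeries.X_pow_dvd_iff.1 (key (n + 1) k) n (Nat.lt_succ_self n)
  rwa [map_sub, sub_eq_zero] at this

/-! ### The generating function of sortable tuples -/

section

variable {r l : ℕ} {lam : Fin (l + 1) → ℕ}

theorem coeff_coeff_genFun (hlast : lam (Fin.last l) = r) (n k : ℕ) :
    PowerSeries.coeff n (PowerSeries.coeff k (genFun r lam)) =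
      ((chunkSet r lam 1 n [k]).ncard : ℚ) := by
  rw [genFun, PowerSeries.coeff_mk, PowerSeries.coeff_mk, ncard_sortableTuples hlast]

theorem coeff_prod_genFun (hpos : 0 < lam 0) (hmono : StrictMono lam)
    (hlast : lam (Fin.last l) = r) (gs : List ℕ) (n : ℕ) :
    PowerSeries.coeff n (gs.map fun g => PowerSeries.coeff g (genFun r lam)).prod =
      ((chunkSet r lam 1 n gs).ncard : ℚ) := by
  induction gs generalizing n with
  | nil =>
    rw [ncard_chunkSet_nil, List.map_nil, List.prod_nil, PowerSeries.coeff_one]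
    split_ifs <;> simp
  | cons g gs ih =>
    rw [List.map_cons, List.prod_cons, PowerSeries.coeff_mul,
      ncard_chunkSet_cons hpos hmono hlast, Nat.cast_sum]
    refine Finset.sum_congr rfl fun p _ => ?_
    rw [ih, coeff_coeff_genFun hlast, ncard_chunkSet_eq hpos hmono hlast (1 + p.1), Nat.cast_mul]

theorem gapProd_eq_prod_gaps (P : Series) :
    gapProd lam P = ((gaps lam).map fun g => PowerSeries.coeff g P).prod := by
  rw [gapProd, gaps, List.map_ofFn, List.prod_ofFn]
  rfl

/-- The summand `1`, which produces `1 / (1 - z̄)`, counts the tuple of empty words. All other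
tuples have a largest letter to delete. -/
theorem solvesWith_genFun (hpos : 0 < lam 0) (hmono : StrictMono lam)
    (hlast : lam (Fin.last l) = r) :
    SolvesWith (lam 0) (PowerSeries.X * gapProd lam (genFun r lam)) (genFun r lam) := by
  rw [solvesWith_iff]
  intro k
  have hsum : ∑ i ∈ Finset.range k, ((splitSizes lam k i).map
      fun g => PowerSeries.coeff g (genFun r lam)).prod =
      gapProd lam (genFun r lam) * ∑ i ∈ Finset.range k,
        PowerSeries.coeff (i + (lam 0 + 1)) (genFun r lam) *
          PowerSeries.coeff (k - 1 - i) (genFun r lam) := by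
    rw [Finset.mul_sum]
    refine Finset.sum_congr rfl fun i _ => ?_
    rw [splitSizes, List.map_append, List.map_cons, List.prod_append, List.prod_cons,
      ← gapProd_eq_prod_gaps, List.map_singleton, List.prod_singleton]
    ring
  rw [mul_assoc, ← hsum]
  ext n
  rw [map_add, coeff_coeff_genFun hlast, PowerSeries.coeff_one]
  cases n with
  | zero =>
    rw [ncard_chunkSet_zero hlast, PowerSeries.coeff_zero_X_mul]
    simp
  | succ n =>
    rw [PowerSeries.coeff_succ_X_mul, ncard_chunkSet_succ hpos hmono hlast, map_sum,
      Nat.cast_sum, if_neg n.succ_ne_zero, zero_add]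
    exact Finset.sum_congr rfl fun i _ => (coeff_prod_genFun hpos hmono hlast _ _).symm

theorem dvd_gapProd_sub {d : ℚ⟦X⟧} {P Q : Series}
    (h : ∀ k, d ∣ PowerSeries.coeff k P - PowerSeries.coeff k Q) :
    d ∣ gapProd lam P - gapProd lam Q := by
  rw [gapProd_eq_prod_gaps, gapProd_eq_prod_gaps]
  generalize gaps lam = gs
  induction gs with
  | nil => simp
  | cons g gs ih =>
    rw [List.map_cons, List.map_cons, List.prod_cons, List.prod_cons]
    rw [mul_sub_mul_eq]
    exact dvd_add (ih.mul_left _) ((h g).mul_right _)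

theorem eq_genFun_of_solves (hpos : 0 < lam 0) (hmono : StrictMono lam)
    (hlast : lam (Fin.last l) = r) {Q : Series} (hQ : SolvesFunctionalEquation lam Q) :
    Q = genFun r lam := by
  refine (solvesFunctionalEquation_iff.1 hQ).unique (solvesWith_genFun hpos hmono hlast)
    (dvd_mul_right _ _) fun n h => ?_
  rw [← mul_sub, pow_succ']
  exact mul_dvd_mul_left _ (dvd_gapProd_sub h)

theorem constantCoeff_gapProd (hlast : lam (Fin.last l) = r) :
    PowerSeries.constantCoeff (gapProd lam (genFun r lam)) = 1 := by
  rw [gapProd, map_prod]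
  refine Finset.prod_eq_one fun i _ => ?_
  rw [← PowerSeries.coeff_zero_eq_constantCoeff_apply, coeff_coeff_genFun hlast,
    ncard_chunkSet_zero hlast, Nat.cast_one]

end


/-! ### The inverse of `y / (1 + y) ^ k` -/

theorem X_eq_mul_inv_iff {k : ℕ} {Y : ℚ⟦X⟧} {x : ℚ⟦X⟧} (hx : x ≠ 0)
    (hx₀ : PowerSeries.constantCoeff x = 0) :
    x = Y * ((1 + Y) ^ k)⁻¹ ↔ PowerSeries.constantCoeff Y = 0 ∧ x * (1 + Y) ^ k = Y := by
  constructor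
  · intro h
    -- The inverse of a series without constant term is `0` by convention, which `x ≠ 0` excludes.
    have hne : PowerSeries.constantCoeff ((1 + Y) ^ k) ≠ 0 := by
      intro h0
      rw [PowerSeries.inv_eq_zero.2 h0, mul_zero] at h
      exact hx h
    have h' : x * (1 + Y) ^ k = Y := by
      conv_lhs => rw [h]
      rw [mul_assoc, PowerSeries.inv_mul_cancel _ hne, mul_one]
    refine ⟨?_, h'⟩
    rw [← h', map_mul, hx₀, zero_mul]
  · rintro ⟨h₀, h⟩
    rw [PowerSeries.eq_mul_inv_iff_mul_eq (by simp [h₀]), h]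

theorem exists_unique_inverse (k : ℕ) : ∃ Y : ℚ⟦X⟧,
    PowerSeries.constantCoeff Y = 0 ∧ PowerSeries.X * (1 + Y) ^ k = Y ∧
      ∀ Y' : ℚ⟦X⟧, PowerSeries.constantCoeff Y' = 0 → PowerSeries.X * (1 + Y') ^ k = Y' →
        Y' = Y := by
  obtain ⟨G, hG⟩ : ∃ G : ℚ⟦X⟧, G * (1 + PowerSeries.X) ^ k = PowerSeries.X :=
    ⟨PowerSeries.X * ((1 + PowerSeries.X) ^ k)⁻¹, by
      rw [mul_assoc, PowerSeries.inv_mul_cancel _ (by simp), mul_one]⟩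
  have hG₀ : PowerSeries.constantCoeff G = 0 := by
    simpa using congrArg PowerSeries.constantCoeff hG
  have hG₁ : PowerSeries.coeff 1 G = 1 := by
    have := congrArg (PowerSeries.coeff 1) hG
    rw [PowerSeries.coeff_mul, Finset.Nat.antidiagonal_succ] at this
    simpa [hG₀] using this
  have hunit : IsUnit (PowerSeries.coeff 1 G) := by rw [hG₁]; exact isUnit_one
  have key : ∀ Y : ℚ⟦X⟧, PowerSeries.constantCoeff Y = 0 →
      PowerSeries.subst Y G * (1 + Y) ^ k = Y := by
    intro Y hY
    have hs : PowerSeries.HasSubst Y := PowerSeries.HasSubst.of_constantCoeff_zero' hY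
    have := congrArg (PowerSeries.subst Y) hG
    rw [← PowerSeries.coe_substAlgHom hs] at this ⊢
    rw [map_mul, map_pow, map_add, map_one, PowerSeries.substAlgHom_X hs] at this
    exact this
  have hY₀ : PowerSeries.constantCoeff (G.substInvOfIsUnit hunit) = 0 := by simp
  refine ⟨G.substInvOfIsUnit hunit, hY₀, ?_, ?_⟩
  · have := key _ hY₀
    rwa [PowerSeries.subst_substInvOfIsUnit_right _ hG₀] at this
  · intro Y' hY' h
    have hs : PowerSeries.HasSubst Y' := PowerSeries.HasSubst.of_constantCoeff_zero' hY'
    have hsG : PowerSeries.HasSubst G := PowerSeries.HasSubst.of_constantCoeff_zero' hG₀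
    have hu : (1 + Y') ^ k ≠ 0 := by
      intro h0
      have := congrArg PowerSeries.constantCoeff h0
      simp [hY'] at this
    -- Thus `Y'` is a right inverse of `G = X / (1 + X)^k` under composition, and substituting it
    -- into the left inverse identity forces it to be the compositional inverse.
    have hX : PowerSeries.subst Y' G = PowerSeries.X :=
      mul_right_cancel₀ hu ((key Y' hY').trans h.symm)
    have := congrArg (PowerSeries.subst Y') (PowerSeries.subst_substInvOfIsUnit_left G hG₀ hunit)
    rw [PowerSeries.subst_comp_subst_apply hsG hs, hX, PowerSeries.subst_X hs] at this
    rw [← this, PowerSeries.X_subst]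

/-! ### The algebraic solution -/

/-- A sequence given by a second order recurrence with coefficients of degree at most `1` in `z̄`
consists of polynomials in `z̄`, the `m`-th one of degree at most `m`. -/
theorem exists_polynomial_of_recurrence (a₀ a b c d e : ℚ⟦X⟧) (W : ℕ → Series)
    (h₀ : W 0 = PowerSeries.C a₀) (h₁ : W 1 = PowerSeries.C a + PowerSeries.C b * PowerSeries.X)
    (h₂ : ∀ m, W (m + 2) = (PowerSeries.C c + PowerSeries.C d * PowerSeries.X) * W (m + 1) -
      PowerSeries.C e * PowerSeries.X * W m) (m : ℕ) :
    ∃ p : Polynomial ℚ⟦X⟧, p.natDegree ≤ m ∧ W m = (p : Series) := by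
  have key : ∀ m, (∃ p : Polynomial ℚ⟦X⟧, p.natDegree ≤ m ∧ W m = (p : Series)) ∧
      ∃ p : Polynomial ℚ⟦X⟧, p.natDegree ≤ m + 1 ∧ W (m + 1) = (p : Series) := by
    intro m
    induction m with
    | zero =>
      refine ⟨⟨Polynomial.C a₀, by simp, by simp [h₀]⟩,
        ⟨Polynomial.C a + Polynomial.C b * Polynomial.X, by compute_degree, by simp [h₁]⟩⟩
    | succ m ih =>
      obtain ⟨⟨p, hp, hWp⟩, q, hq, hWq⟩ := ih
      refine ⟨⟨q, hq, hWq⟩,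
        (Polynomial.C c + Polynomial.C d * Polynomial.X) * q - Polynomial.C e * Polynomial.X * p,
        ?_, by simp [h₂, hWp, hWq]⟩
      refine (Polynomial.natDegree_sub_le _ _).trans (max_le ?_ ?_)
      · refine (Polynomial.natDegree_mul_le_of_le (m := 1) (by compute_degree) hq).trans (by omega)
      · refine (Polynomial.natDegree_mul_le_of_le (m := 1) (by compute_degree) hp).trans (by omega)
  exact (key m).1

/-- The power sums of the two conjugate roots, in terms of the Catalan series `c`, are polynomials
in `z̄`. -/
theorem exists_polynomial_powerSum {y E : ℚ⟦X⟧} {c ci β : Series} (hE : E = 1 + y)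
    (hci : c * ci = 1) (hβ : (1 + PowerSeries.C y * c) * β = 1)
    (hc : (1 - PowerSeries.X) * (c - 1) = PowerSeries.C (y * E) * PowerSeries.X * c ^ 2) (m : ℕ) :
    ∃ p : Polynomial ℚ⟦X⟧, p.natDegree ≤ m ∧
      PowerSeries.C E ^ m * ((PowerSeries.C E * c - 1) * ci * β ^ m +
        (1 + PowerSeries.C y * c) * ci * (PowerSeries.X * (1 + PowerSeries.C y * c)) ^ m) =
          (p : Series) := by
  subst hE
  simp only [map_add, map_mul, map_one] at hc ⊢
  set v : Series := PowerSeries.C y with hv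
  set z : Series := PowerSeries.X with hz
  obtain ⟨B, hB⟩ : ∃ B, B = 1 + v * c := ⟨_, rfl⟩
  rw [← hB] at hβ ⊢
  -- If `c'` is the other root, then `(1 + y c)(1 + y c') = 1 / z̄`, so `z̄ B` is the conjugate of
  -- `β`. The scaled roots `E β` and `E z̄ B` have the sum found here and the product `E² z̄`, which
  -- are the coefficients of the recurrence.
  have hs : (1 + v) * (β + z * B) = 1 + (1 + 2 * v) * z := by
    have h : (1 + v) * (1 + z * B ^ 2) = B * (1 + z + 2 * z * v) := by
      rw [hB]
      linear_combination (-v) * hc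
    linear_combination β * h - ((1 + v) * z * B - (1 + z + 2 * z * v)) * hβ
  refine exists_polynomial_of_recurrence (1 + 2 * y) y ((1 + 4 * y) * (1 + y) - y) 1 (1 + 2 * y)
    ((1 + y) ^ 2)
    (fun m => (1 + v) ^ m * (((1 + v) * c - 1) * ci * β ^ m + B * ci * (z * B) ^ m)) ?_ ?_ ?_ m
  · simp only [map_add, map_mul, map_one, map_ofNat, ← hv]
    rw [hB]
    linear_combination (1 + 2 * v) * hci
  · simp only [map_add, map_sub, map_mul, map_one, map_ofNat, ← hv, ← hz]
    -- The initial value at `1`, cleared of denominators by the unit `c B`.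
    have h : (1 + v) * (((1 + v) * c - 1) + z * B ^ 3) =
        c * B * (v + ((1 + 4 * v) * (1 + v) - v) * z) := by
      rw [hB]
      linear_combination (1 + v - v ^ 2 * c) * hc
    have hu : IsUnit (c * B) := (IsUnit.of_mul_eq_one _ hci).mul (IsUnit.of_mul_eq_one _ hβ)
    refine hu.mul_left_cancel ?_
    rw [← h]
    linear_combination ((1 + v) * ((1 + v) * c - 1) * B * β + (1 + v) * z * B ^ 3) * hci +
      (1 + v) * ((1 + v) * c - 1) * hβ
  · intro m
    simp only [map_add, map_mul, map_one, map_ofNat, map_pow, ← hv, ← hz]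
    linear_combination
      (1 + v) ^ (m + 1) * (((1 + v) * c - 1) * ci * β ^ (m + 1) + B * ci * (z * B) ^ (m + 1)) * hs -
      (1 + v) ^ (m + 2) * z * (((1 + v) * c - 1) * ci * β ^ m + B * ci * (z * B) ^ m) * hβ


/-- With `V` the polynomial of degree at most `m` below, the quadratic relation `e F (y F - V) =
z̄^m (F - 1/(1 - z̄))` holds. It becomes the functional equation once `V` is recognised as `y` times
the truncation of `F` to degrees at most `m`. -/
theorem solvesWith_closedForm {m : ℕ} {y E e : ℚ⟦X⟧} {c ci β : Series} (hE : E = 1 + y)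
    (he : e * E ^ (2 * m + 1) = 1) (hci : c * ci = 1) (hβ : (1 + PowerSeries.C y * c) * β = 1)
    (hc : (1 - PowerSeries.X) * (c - 1) = PowerSeries.C (y * E) * PowerSeries.X * c ^ 2) :
    SolvesWith m (y * e) (geomSeries * c * (PowerSeries.C E ^ (m + 1) * β ^ (m + 1))) := by
  obtain ⟨p, hp, hV⟩ := exists_polynomial_powerSum hE hci hβ hc m
  set F : Series := geomSeries * c * (PowerSeries.C E ^ (m + 1) * β ^ (m + 1)) with hF
  obtain ⟨B, hB⟩ : ∃ B, B = 1 + PowerSeries.C y * c := ⟨_, rfl⟩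
  rw [← hB] at hβ hV
  obtain ⟨V, hVdef⟩ : ∃ V : Series, V = (p : Series) -
      PowerSeries.X ^ m * PowerSeries.C E ^ (2 * m + 1) := ⟨_, rfl⟩
  have hCe : (PowerSeries.C e : Series) * PowerSeries.C E ^ (2 * m + 1) = 1 := by
    rw [← map_pow, ← map_mul, he, map_one]
  have hA : (PowerSeries.C E * c - 1) * B * (1 - PowerSeries.X) = PowerSeries.C (y * E) * c ^ 2 := by
    rw [hB, hE]
    rw [hE] at hc
    simp only [map_add, map_mul, map_one] at hc ⊢
    linear_combination hc
  -- Multiplied by `E^m β^m`, the left side is the first term of the trace and the right side is `y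
  -- F`.
  have hA' : (PowerSeries.C E * c - 1) * ci = PowerSeries.C (y * E) * c * geomSeries * β := by
    linear_combination ci * β * geomSeries * hA -
      (PowerSeries.C E * c - 1) * ci * B * β * geomSeries_mul -
      (PowerSeries.C E * c - 1) * ci * hβ + PowerSeries.C (y * E) * c * geomSeries * β * hci
  have hyF : PowerSeries.C y * F - V =
      PowerSeries.X ^ m * (PowerSeries.C E ^ (2 * m + 1) - PowerSeries.C E ^ m * B ^ (m + 1) * ci) := by
    rw [hVdef, ← hV, hA', hF, map_mul]
    ring
  have hkey : PowerSeries.C e * F * (PowerSeries.C y * F - V) =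
      PowerSeries.X ^ m * (F - geomSeries) := by
    have hpow : B ^ (m + 1) * β ^ (m + 1) = 1 := by rw [← mul_pow, hβ, one_pow]
    have h₁ : PowerSeries.C e * F * (PowerSeries.C E ^ m * B ^ (m + 1) * ci) = geomSeries := by
      rw [hF]
      linear_combination geomSeries * c * ci * (B ^ (m + 1) * β ^ (m + 1)) * hCe +
        geomSeries * c * ci * hpow + geomSeries * hci
    rw [hyF]
    linear_combination PowerSeries.X ^ m * F * hCe - PowerSeries.X ^ m * h₁
  have hc₀ : PowerSeries.constantCoeff c = 1 := by
    have := congrArg PowerSeries.constantCoeff hc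
    simpa [sub_eq_zero] using this
  have hF₀ : PowerSeries.constantCoeff F = 1 := by
    have h := congrArg PowerSeries.constantCoeff hβ
    rw [hB, map_mul, map_add, map_mul, hc₀, PowerSeries.constantCoeff_C, map_one, mul_one,
      ← hE] at h
    have hg := congrArg PowerSeries.constantCoeff geomSeries_mul
    simp only [map_mul, map_sub, map_one, PowerSeries.constantCoeff_X, sub_zero, mul_one] at hg
    rw [hF, map_mul, map_mul, map_mul, map_pow, map_pow, hc₀, hg, PowerSeries.constantCoeff_C,
      ← mul_pow, h, one_pow, mul_one, mul_one]
  have hunit : IsUnit (PowerSeries.C e * F) :=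
    ((IsUnit.of_mul_eq_one _ he).map PowerSeries.C).mul
      (PowerSeries.isUnit_iff_constantCoeff.2 (hF₀ ▸ isUnit_one))
  -- The relation supplies the factor `z̄^m`. One more comes from `F` and `1/(1 - z̄)` having the
  -- same constant term, and `e F` is a unit.
  have hdvd : PowerSeries.X ^ (m + 1) ∣ PowerSeries.C y * F - V := by
    rw [← hunit.dvd_mul_left, hkey, pow_succ]
    refine mul_dvd_mul_left _ (PowerSeries.X_dvd_iff.2 ?_)
    have hg := congrArg PowerSeries.constantCoeff geomSeries_mul
    simp only [map_mul, map_sub, map_one, PowerSeries.constantCoeff_X, sub_zero, mul_one] at hg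
    rw [map_sub, hF₀, hg, sub_self]
  -- Above degree `m` the polynomial `V` vanishes; up to degree `m` the difference vanishes by
  -- divisibility.
  have hshift : PowerSeries.C y * F - V =
      PowerSeries.C y * (PowerSeries.X ^ (m + 1) * shift (m + 1) F) := by
    ext1 n
    rw [PowerSeries.coeff_C_mul, PowerSeries.coeff_X_pow_mul']
    split_ifs with h
    · have h₁ : PowerSeries.coeff n V = 0 := by
        rw [hVdef, map_sub, Polynomial.coeff_coe, Polynomial.coeff_eq_zero_of_natDegree_lt (by omega),
          ← map_pow, mul_comm, PowerSeries.coeff_C_mul, PowerSeries.coeff_X_pow, if_neg (by omega),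
          mul_zero, sub_zero]
      rw [map_sub, h₁, sub_zero, PowerSeries.coeff_C_mul, shift, PowerSeries.coeff_mk,
        Nat.sub_add_cancel h]
    · rw [mul_zero]
      exact PowerSeries.X_pow_dvd_iff.1 hdvd n (by omega)
  rw [hshift] at hkey
  rw [SolvesWith, ← sub_eq_iff_eq_add']
  have hX : (PowerSeries.X ^ m : Series) ≠ 0 := pow_ne_zero _ PowerSeries.X_ne_zero
  refine mul_left_cancel₀ hX ?_
  rw [← hkey, map_mul]
  ring

theorem catalanGF_eq : catalanGF ^ 2 * PowerSeries.X + 1 = catalanGF := by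
  have := congrArg (PowerSeries.map (Nat.castRingHom ℚ)) PowerSeries.catalanSeries_sq_mul_X_add_one
  simpa [catalanGF] using this

theorem subst_catalanGF {t : Series} (ht : PowerSeries.HasSubst t) :
    (PowerSeries.subst t catalanGF : Series) =
      1 + t * (PowerSeries.subst t catalanGF : Series) ^ 2 := by
  have := congrArg (PowerSeries.subst t) catalanGF_eq
  rw [← PowerSeries.coe_substAlgHom ht] at this ⊢
  rw [map_add, map_mul, map_pow, map_one, PowerSeries.substAlgHom_X ht] at this
  linear_combination -this

end StackSort

theorem mainTheorem12 (r l : ℕ) (lam : Fin (l + 1) → ℕ) (hpos : 0 < lam 0)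
    (hmono : StrictMono lam) (hlast : lam (Fin.last l) = r) :
    -- the generating function is the unique power series solution of the functional equation
    SolvesFunctionalEquation lam (genFun r lam) ∧
    (∀ Q : Series, SolvesFunctionalEquation lam Q → Q = genFun r lam) ∧
    -- `Y` is the unique formal power series `y` in an indeterminate `X` with
    -- `X = y / (1 + y) ^ (2 λ₀ + 1)`
    ∃ Y : ℚ⟦X⟧,
      (∀ Y' : ℚ⟦X⟧, PowerSeries.X = Y' * ((1 + Y') ^ (2 * lam 0 + 1))⁻¹ ↔ Y' = Y) ∧
      -- `x` and `y = Y(x)` as power series in `u`, `t` as a power series in `u` and `z̄`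
      ∃ (x y : ℚ⟦X⟧) (t : Series),
        x = PowerSeries.X * gapProd lam (genFun r lam) ∧
        PowerSeries.HasSubst x ∧
        y = PowerSeries.subst x Y ∧
        y ≠ 0 ∧
        x = y * ((1 + y) ^ (2 * lam 0 + 1))⁻¹ ∧
        toFrac t = ofU x * (1 + ofU y) ^ (2 * (lam 0 + 1)) * (zVar / (1 - zVar)) ∧
        toFrac t = ofU y * (1 + ofU y) * (zVar / (1 - zVar)) ∧
        PowerSeries.HasSubst t ∧
        IsUnit (1 + PowerSeries.C y * (PowerSeries.subst t catalanGF : Series)) ∧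
        toFrac (genFun r lam) =
          (1 + toFrac t / (ofU y * (1 + ofU y))) *
            (toFrac (PowerSeries.subst t catalanGF) * (1 + ofU y) ^ (lam 0 + 1) /
              (1 + ofU y * toFrac (PowerSeries.subst t catalanGF)) ^ (lam 0 + 1)) := by
  have hsolves := solvesWith_genFun hpos hmono hlast
  refine ⟨solvesFunctionalEquation_iff.2 hsolves,
    fun Q hQ => eq_genFun_of_solves hpos hmono hlast hQ, ?_⟩
  obtain ⟨Y, hY₀, hYX, hYuniq⟩ := exists_unique_inverse (2 * lam 0 + 1)
  refine ⟨Y, fun Y' => ?_, ?_⟩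
  · rw [X_eq_mul_inv_iff PowerSeries.X_ne_zero PowerSeries.constantCoeff_X]
    constructor
    · rintro ⟨h₀, h⟩
      exact hYuniq Y' h₀ h
    · rintro rfl
      exact ⟨hY₀, hYX⟩
  obtain ⟨x, hx⟩ : ∃ x, x = PowerSeries.X * gapProd lam (genFun r lam) := ⟨_, rfl⟩
  rw [← hx] at hsolves
  have hx₀ : PowerSeries.constantCoeff x = 0 := by simp [hx]
  -- The product has constant term `1`. From `x ≠ 0` follows `y ≠ 0`, so dividing by `y (1 + y)` is
  -- meaningful.
  have hxne : x ≠ 0 := by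
    rw [hx]
    refine mul_ne_zero PowerSeries.X_ne_zero fun h => ?_
    have := constantCoeff_gapProd (lam := lam) hlast
    rw [h, map_zero] at this
    exact zero_ne_one this
  have hxs : PowerSeries.HasSubst x := PowerSeries.HasSubst.of_constantCoeff_zero' hx₀
  obtain ⟨y, hy⟩ : ∃ y : ℚ⟦X⟧, y = PowerSeries.subst x Y := ⟨_, rfl⟩
  have hxy : x * (1 + y) ^ (2 * lam 0 + 1) = y := by
    have := congrArg (PowerSeries.subst x) hYX
    rw [← PowerSeries.coe_substAlgHom hxs] at this hy
    rw [map_mul, map_pow, map_add, map_one, PowerSeries.substAlgHom_X hxs, ← hy] at this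
    exact this
  have hy₀ : PowerSeries.constantCoeff y = 0 := by rw [← hxy, map_mul, hx₀, zero_mul]
  have hyne : y ≠ 0 := by
    rintro rfl
    simp at hxy
    exact hxne hxy
  have hEne : 1 + y ≠ 0 := by
    intro h
    have := congrArg PowerSeries.constantCoeff h
    simp [hy₀] at this
  have hxy' : x = y * ((1 + y) ^ (2 * lam 0 + 1))⁻¹ :=
    (X_eq_mul_inv_iff hxne hx₀).2 ⟨hy₀, hxy⟩
  obtain ⟨t, ht⟩ : ∃ t : Series, t = PowerSeries.C (y * (1 + y)) * (PowerSeries.X * geomSeries) :=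
    ⟨_, rfl⟩
  have hts : PowerSeries.HasSubst t :=
    PowerSeries.HasSubst.of_constantCoeff_zero' (by simp [ht])
  have htf : toFrac t = ofU y * (1 + ofU y) * (zVar / (1 - zVar)) := by
    rw [ht, map_mul, map_mul toFrac PowerSeries.X, toFrac_geomSeries, mul_one_div,
      ← map_one ofU, ← map_add, ← map_mul]
    rfl
  obtain ⟨c, hcdef⟩ : ∃ c : Series, c = PowerSeries.subst t catalanGF := ⟨_, rfl⟩
  have hct : c = 1 + t * c ^ 2 := hcdef ▸ subst_catalanGF hts
  have hc₀ : PowerSeries.constantCoeff c = 1 := by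
    have := congrArg PowerSeries.constantCoeff hct
    simpa [ht] using this
  have hcu : IsUnit c := PowerSeries.isUnit_iff_constantCoeff.2 (hc₀ ▸ isUnit_one)
  have hEu : IsUnit (1 + y) :=
    PowerSeries.isUnit_iff_constantCoeff.2 (by simp [hy₀])
  have hBu : IsUnit (1 + PowerSeries.C y * c) :=
    PowerSeries.isUnit_iff_constantCoeff.2 (by simpa [hc₀] using hEu)
  refine ⟨x, y, t, hx, hxs, hy, hyne, hxy', ?_, htf, hts, hcdef ▸ hBu, ?_⟩
  · rw [htf]
    congr 1
    have := congrArg ofU hxy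
    rw [map_mul, map_pow, map_add, map_one] at this
    linear_combination -(1 + ofU y) * this
  obtain ⟨ci, hci⟩ := hcu.exists_right_inv
  obtain ⟨β, hβ⟩ := hBu.exists_right_inv
  have hc : (1 - PowerSeries.X) * (c - 1) =
      PowerSeries.C (y * (1 + y)) * PowerSeries.X * c ^ 2 := by
    rw [ht] at hct
    linear_combination (1 - PowerSeries.X) * hct +
      PowerSeries.C (y * (1 + y)) * PowerSeries.X * c ^ 2 * geomSeries_mul
  have hclosed := solvesWith_closedForm (m := lam 0) rfl
    (PowerSeries.inv_mul_cancel ((1 + y) ^ (2 * lam 0 + 1)) (by simp [hy₀])) hci hβ hc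
  rw [← hxy'] at hclosed
  -- Both series solve the equation with the same `x`, so the condition on the difference of the
  -- factors is trivial.
  have hP := hsolves.unique hclosed (PowerSeries.X_dvd_iff.2 hx₀) (by simp)
  have hy' : ofU y ≠ 0 := by
    rw [ofU, RingHom.comp_apply]
    exact (map_ne_zero_iff _ toFrac_injective).2
      ((map_ne_zero_iff _ PowerSeries.C_injective).2 hyne)
  have hE' : 1 + ofU y ≠ 0 := by
    rw [← map_one ofU, ← map_add, ofU, RingHom.comp_apply]
    exact (map_ne_zero_iff _ toFrac_injective).2
      ((map_ne_zero_iff _ PowerSeries.C_injective).2 hEne)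
  have hβ' : (1 + ofU y * toFrac c) * toFrac β = 1 := by
    rw [ofU, RingHom.comp_apply, ← map_one toFrac, ← map_mul, ← map_add, ← map_mul, hβ]
  -- The prefactor of the stated formula is the geometric series in disguise, because `t / (y (1 +
  -- y)) = z̄ / (1 - z̄)`.
  have hone : 1 + toFrac t / (ofU y * (1 + ofU y)) = 1 / (1 - zVar) := by
    have := one_sub_zVar_ne_zero
    rw [htf]
    field_simp
    ring
  have hCE : toFrac (PowerSeries.C (1 + y)) = 1 + ofU y := by
    rw [map_add, map_one, map_add, map_one]
    rfl
  rw [← hcdef, hone, hP, map_mul, map_mul, toFrac_geomSeries, map_mul, map_pow, map_pow, hCE,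
    eq_inv_of_mul_eq_one_right hβ', div_eq_mul_inv (_ * _), inv_pow]
  ring
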